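/- Model. Let $\lambda,\mu_1,\mu_2,\beta>0$ with $\mu_1<\mu_2$ and $\lambda+\mu_1+\mu_2+\beta=1$, let $c_{\mu_1}=0<c_{\mu_2}$, and fix $\mu\in\{\mu_1,\mu_2\}$ with $\mu>\lambda$. Let $h:\mathbb N_0\to[0,\infty)$ be non-decreasing, convex and unbounded with $h(0)=0$ and $\sum_i h(i)x^i<\infty$ for all $0<x<1$. A policy $\phi\in\Phi$ chooses a rate $\phi(i)\in\{\mu_1,\mu_2\}$ for every $i\in\mathbb N_0$. On $S=\mathbb N_0\times\{0,1\}$ let $P^\phi=(p^\phi_{x,y})$ be the transition matrix that moves $(i,1)$ to $(i+1,1)$ with probability $\lambda$, to $(i,0)$ with probability $\beta$, to $(i-1,1)$ with probability $\phi(i)\mathbf 1_{\{i>0\}}$, and otherwise stays; and moves $(i,0)$ to $(i+1,0)$ with probability $\lambda$, to $(i-1,0)$ with probability $\mu\mathbf 1_{\{i>0\}}$, and otherwise stays. The costs are $c^\phi(i,1)=c_{\phi(i)}+h(i)$ and $c^\phi(i,0)=c_\mu+h(i)$. For a law $p$ on $\mathbb N_0$ let $X,Y$ be independent Markov chains with transition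 matrix $P^\phi$, where $X_0=(I,0)$, $Y_0=(J,1)$ and $I,J$ have law $p$, and put $$s^\phi(p)=\sum_{n\ge0}\mathbb E\big[c^\phi(X_n)-c^\phi(Y_n)\big],\qquad s(p)=\sup_{\phi\in\Phi}s^\phi(p).$$ Let $\rho_\mu=\lambda/\mu$, $\pi_\mu(i)=(1-\rho_\mu)\rho_\mu^i$ and $g_\mu=c_\mu+\sum_i h(i)\pi_\mu(i)$. Constants. Let $1<\zeta<\min\{1/(1-\beta),\,1+\beta/\lambda\}$, where moreover $\zeta<\mu_1/\lambda$ if $\mu_1>\lambda$, and $$\zeta<\min\Big\{\frac{\mu}{\lambda},\ \frac{\lambda+\frac\beta2+\mu_1+\sqrt{(\lambda+\frac\beta2+\mu_1)^2-4\lambda\mu_1}}{2\lambda}\Big\}\quad\text{if }\mu_1\le\lambda.$$ Put $M(i,0)=\frac12\zeta^i$, $M(i,1)=\zeta^i$, $\|f\|_M=\sup_{x\in S}|f(x)|/M(x)$, and $$\eta=1-\lambda+\lambda\zeta+\max\big\{-\beta,\ -(1-\tfrac1\zeta)\mu,\ -(1-\tfrac1\zeta)\mu_1-\tfrac12\beta\big\}.$$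 Theorem. (i) There is a unique pair $(g^*,H^*)$ with $g^*\in\mathbb R$, $\|H^*\|_M<\infty$, $H^*(0,0)=0$ that solves the average-cost optimality equation $$g^*+H^*(x)=\min_{\phi\in\Phi}\Big\{c^\phi(x)+\sum_{y\in S}p^\phi_{x,y}H^*(y)\Big\},\qquad x\in S,$$ and $g^*=g_\mu$. (ii) There are finite constants $u_M$ with $u_M\ge\max\{\sup_\phi\|c^\phi\|_M,\ \|g_\mu\mathbf 1\|_M\}$; the values $s^\phi(\pi_\mu)$, $\phi\in\Phi$, exist (all the expectations are finite and their series converges), and $s(\pi_\mu)$ is finite. (iii) For each such $u_M$ and each $\varepsilon>0$ let $$\tilde k_\varepsilon=\Big\lceil\log_{\rho_\mu\zeta}\Big(\frac{\varepsilon(1-\eta)(1-\rho_\mu\zeta)}{4u_M(1-\rho_\mu)}\Big)\Big\rceil\in\mathbb Z,\qquad \tilde K=g_\mu+u_M+\frac{\beta u_M}{1-\eta},$$ $$\tilde n_{\varepsilon,k}=\max\Big\{0,\Big\lceil\log_{(1-\beta)\zeta}\Big(\frac{\varepsilon(1-(1-\beta)\zeta)}{\tilde K\zeta^k}\Big)\Big\rceil\Big\}\qquad(k\in\mathbb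 N_0).$$ Let $V'_{\beta,0}\equiv0$ and, for $i,n\in\mathbb N_0$, $$V'_{\beta,n+1}(i)=\min_{a\in\{\mu_1,\mu_2\}}\Big\{c_a+h(i)-g_\mu+\beta H^*(i,0)+(1-\beta)\Big(\tfrac{\lambda}{1-\beta}V'_{\beta,n}(i+1)+\tfrac{a}{1-\beta}V'_{\beta,n}((i-1)^+)+\big(1-\tfrac{\lambda+a}{1-\beta}\big)V'_{\beta,n}(i)\Big)\Big\},$$ and put $\tilde H_{\varepsilon/2}(i,1)=V'_{\beta,\tilde n_{\varepsilon/2,\tilde k_\varepsilon}}(i)$ for $0\le i\le\tilde k_\varepsilon$. Then $|\tilde H_{\varepsilon/2}(i,1)-H^*(i,1)|\le\varepsilon/2$ for $0\le i\le\tilde k_\varepsilon$, and $$\Big|\,s(\pi_\mu)-\sum_{0\le i\le\tilde k_\varepsilon}(1-\rho_\mu)\rho_\mu^i\big(H^*(i,0)-\tilde H_{\varepsilon/2}(i,1)\big)\Big|\le\varepsilon,$$ where the sum is empty if $\tilde k_\varepsilon<0$. -/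

import Mathlib

open MeasureTheory ProbabilityTheory

/-- The two service rates: `slow` is `μ₁`, `fast` is `μ₂`. -/
inductive Rate where
  | slow : Rate
  | fast : Rate

/-- Numerical data of the M/M/1 queue with one temporary period of service rate control:
arrival rate `lam`, service rates `mu1`, `mu2`, rate `beta` at which control is lost, cost rate
`c2` of `μ₂` (that of `μ₁` is `0`), holding cost `h`, and the rate `base` that is used
(at its own cost) whenever there is no control. -/
structure QueueData where
  lam : ℝ
  mu1 : ℝ
  mu2 : ℝ
  beta : ℝ
  c2 : ℝ
  h : ℕ → ℝ
  base : Rate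

namespace QueueData

/-- The numerical service rate of an action. -/
def rate (D : QueueData) : Rate → ℝ
  | Rate.slow => D.mu1
  | Rate.fast => D.mu2

/-- The cost per time unit of an action. -/
def rateCost (D : QueueData) : Rate → ℝ
  | Rate.slow => 0
  | Rate.fast => D.c2

/-- The fixed service rate `μ` without control. -/
def mu (D : QueueData) : ℝ := D.rate D.base

/-- The cost `c_μ` of the fixed service rate. -/
def cmu (D : QueueData) : ℝ := D.rateCost D.base

end QueueData

/-- The standing assumptions; the time unit is such that the rates add up to one. -/
structure QueueModel extends QueueData where
  lam_pos : 0 < lam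
  mu1_pos : 0 < mu1
  mu1_lt_mu2 : mu1 < mu2
  beta_pos : 0 < beta
  rates_sum : lam + mu1 + mu2 + beta = 1
  c2_pos : 0 < c2
  stable : lam < toQueueData.mu
  h_zero : h 0 = 0
  h_nonneg : ∀ i, 0 ≤ h i
  h_mono : Monotone h
  h_convex : ∀ i, h (i + 1) - h i ≤ h (i + 2) - h (i + 1)
  h_unbounded : ¬ BddAbove (Set.range h)
  h_summable : ∀ x : ℝ, 0 < x → x < 1 → Summable fun i : ℕ => h i * x ^ i

/-- `(i, true)` is the state with `i` customers and with control, `(i, false)` the one without. -/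
abbrev QState : Type := ℕ × Bool

/-- A stationary deterministic policy: `φ i` is the action in state `(i, true)`. In the states
`(i, false)` the only action is the fixed rate. -/
abbrev Policy : Type := ℕ → Rate

namespace QueueModel

noncomputable section

variable (Q : QueueModel)

/-- One-stage cost `c^φ`. -/
def cost (φ : Policy) : QState → ℝ
  | (i, true) => Q.rateCost (φ i) + Q.h i
  | (i, false) => Q.cmu + Q.h i

/-- Transition law `p^φ_{x,·}` of the uniformised chain. In an empty system a service
completion leaves the state unchanged, since `0 - 1 = 0` in `ℕ`. -/
def stepLaw (φ : Policy) : QState → Measure QState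
  | (i, true) =>
      ENNReal.ofReal Q.lam • Measure.dirac (i + 1, true)
      + ENNReal.ofReal Q.beta • Measure.dirac (i, false)
      + ENNReal.ofReal (Q.rate (φ i)) • Measure.dirac (i - 1, true)
      + ENNReal.ofReal (1 - Q.lam - Q.beta - Q.rate (φ i)) • Measure.dirac (i, true)
  | (i, false) =>
      ENNReal.ofReal Q.lam • Measure.dirac (i + 1, false)
      + ENNReal.ofReal Q.mu • Measure.dirac (i - 1, false)
      + ENNReal.ofReal (1 - Q.lam - Q.mu) • Measure.dirac (i, false)

lemma rate_pos (a : Rate) : 0 < Q.rate a := by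
  have h1 := Q.mu1_pos
  have h2 := Q.mu1_lt_mu2
  cases a
  · exact h1
  · exact h1.trans h2

lemma rate_le (a : Rate) : Q.lam + Q.beta + Q.rate a ≤ 1 := by
  have h1 := Q.mu1_pos
  have h2 := Q.mu1_lt_mu2
  have h3 := Q.rates_sum
  cases a
  · change Q.lam + Q.beta + Q.mu1 ≤ 1
    linarith
  · change Q.lam + Q.beta + Q.mu2 ≤ 1
    linarith

instance stepLaw_isProbabilityMeasure (φ : Policy) (x : QState) :
    IsProbabilityMeasure (Q.stepLaw φ x) := by
  constructor
  have h1 := Q.lam_pos.le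
  have h2 := Q.beta_pos.le
  obtain ⟨i, q⟩ := x
  cases q
  · have h3 : 0 ≤ Q.mu := (Q.rate_pos Q.base).le
    have h4 : Q.lam + Q.beta + Q.mu ≤ 1 := Q.rate_le Q.base
    simp only [stepLaw, Measure.add_apply, Measure.smul_apply, measure_univ, smul_eq_mul, mul_one]
    rw [← ENNReal.ofReal_add h1 h3, ← ENNReal.ofReal_add (by linarith) (by linarith)]
    simp
  · have h3 := (Q.rate_pos (φ i)).le
    have h4 := Q.rate_le (φ i)
    simp only [stepLaw, Measure.add_apply, Measure.smul_apply, measure_univ, smul_eq_mul, mul_one]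
    rw [← ENNReal.ofReal_add h1 h2, ← ENNReal.ofReal_add (by linarith) h3,
      ← ENNReal.ofReal_add (by linarith) (by linarith)]
    simp

/-- The transition kernel `P^φ`. -/
def stepKernel (φ : Policy) : Kernel QState QState :=
  Kernel.ofFunOfCountable (Q.stepLaw φ)

instance stepKernel_isMarkovKernel (φ : Policy) : IsMarkovKernel (Q.stepKernel φ) :=
  ⟨fun x => Q.stepLaw_isProbabilityMeasure φ x⟩

/-- The law of the next state given the history up to time `n`: it depends only on the
state at time `n`. -/
def historyKernel (φ : Policy) (n : ℕ) :
    Kernel ((_i : Finset.Iic n) → QState) QState :=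
  (Q.stepKernel φ).comap (fun ω => ω ⟨n, Finset.mem_Iic.2 le_rfl⟩) (measurable_pi_apply _)

instance historyKernel_isMarkovKernel (φ : Policy) (n : ℕ) :
    IsMarkovKernel (Q.historyKernel φ n) := by
  unfold historyKernel
  infer_instance

/-- The law of the Markov chain `(X_n)` with initial law `p` and transition kernel `P^φ`. -/
def chainLaw (φ : Policy) (p : Measure QState) : Measure (ℕ → QState) :=
  Kernel.trajMeasure (X := fun _ => QState) p (Q.historyKernel φ)

/-- The initial law `p^0` (`q = false`) or `p^1` (`q = true`) induced by the law `p` of the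
queue length. -/
def startLaw (p : Measure ℕ) (q : Bool) : Measure QState := p.map fun i => (i, q)

/-- The joint law of the chain `X` started without control and the independent chain `Y`
started with control under the policy `φ`. -/
def pairLaw (φ : Policy) (p : Measure ℕ) : Measure ((ℕ → QState) × (ℕ → QState)) :=
  (Q.chainLaw φ (startLaw p false)).prod (Q.chainLaw φ (startLaw p true))

/-- `v` is the expected total non-discounted saved cost `s^φ(p) = E[∑ₙ (c(Xₙ) - c(Yₙ))]`:
all terms are integrable and their expectations sum up to `v`. -/
def IsSavedCost (φ : Policy) (p : Measure ℕ) (v : ℝ) : Prop :=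
  (∀ n : ℕ, Integrable (fun ω : (ℕ → QState) × (ℕ → QState) =>
      Q.cost φ (ω.1 n) - Q.cost φ (ω.2 n)) (Q.pairLaw φ p)) ∧
  HasSum (fun n : ℕ => ∫ ω, (Q.cost φ (ω.1 n) - Q.cost φ (ω.2 n)) ∂(Q.pairLaw φ p)) v

/-- `v` is the optimal saved cost `s(p)`, the supremum of `s^φ(p)` over all policies
(and every `s^φ(p)` exists). -/
def IsOptimalSavedCost (p : Measure ℕ) (v : ℝ) : Prop :=
  ∃ s : Policy → ℝ, (∀ φ, Q.IsSavedCost φ p (s φ)) ∧ IsLUB (Set.range s) v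

/-- The traffic intensity `ρ_μ = λ / μ`. -/
def rho : ℝ := Q.lam / Q.mu

/-- The stationary queue length law `π_μ(i) = (1 - ρ_μ) ρ_μ ^ i` of the uncontrolled queue. -/
def statLaw : Measure ℕ :=
  Measure.sum fun i : ℕ => ENNReal.ofReal ((1 - Q.rho) * Q.rho ^ i) • Measure.dirac i

/-- The average expected cost `g_μ`. -/
def gmu : ℝ := Q.cmu + ∑' i : ℕ, Q.h i * ((1 - Q.rho) * Q.rho ^ i)

/-- The weight function `M`: `M(i,0) = ζ ^ i / 2`, `M(i,1) = ζ ^ i`. -/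
def weight (ζ : ℝ) : QState → ℝ
  | (i, true) => ζ ^ i
  | (i, false) => ζ ^ i / 2

/-- The range of the weight parameter `ζ`. -/
def Admissible (ζ : ℝ) : Prop :=
  1 < ζ ∧ ζ < 1 / (1 - Q.beta) ∧ ζ < 1 + Q.beta / Q.lam ∧
  ((Q.lam < Q.mu1 ∧ ζ < Q.mu1 / Q.lam) ∨
   (Q.mu1 ≤ Q.lam ∧ ζ < Q.mu / Q.lam ∧
    ζ < ((Q.lam + Q.beta / 2 + Q.mu1)
          + Real.sqrt ((Q.lam + Q.beta / 2 + Q.mu1) ^ 2 - 4 * Q.lam * Q.mu1)) / (2 * Q.lam)))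

/-- The recurrence constant `η`. -/
def eta (ζ : ℝ) : ℝ :=
  1 - Q.lam + Q.lam * ζ
    + max (-Q.beta) (max (-((1 - 1 / ζ) * Q.mu)) (-((1 - 1 / ζ) * Q.mu1) - Q.beta / 2))

/-- `u` bounds the `M`-norms of all cost functions `c^φ` and of the constant function `g_μ`. -/
def IsCostBound (ζ u : ℝ) : Prop :=
  (∀ φ x, |Q.cost φ x| ≤ u * weight ζ x) ∧ ∀ x, |Q.gmu| ≤ u * weight ζ x

/-- `(g, H)` is an `M`-bounded solution of the average cost optimality equation
`g + H(x) = min_φ {c^φ(x) + ∑_y p^φ_{x,y} H(y)}`, normalised by `H(0,0) = 0`. -/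
def IsRelativeValue (ζ g : ℝ) (H : QState → ℝ) : Prop :=
  (∃ C : ℝ, ∀ x, |H x| ≤ C * weight ζ x) ∧ H (0, false) = 0 ∧
  ∀ x, IsLeast (Set.range fun φ : Policy => Q.cost φ x + ∫ y, H y ∂(Q.stepKernel φ x)) (g + H x)

/-- One-stage cost `c_a + h(i) - g_μ + β H*(i,0)` of the auxiliary `β`-discounted model. -/
def auxCost (H : QState → ℝ) (a : Rate) (i : ℕ) : ℝ :=
  Q.rateCost a + Q.h i - Q.gmu + Q.beta * H (i, false)

/-- Expectation of `V` after one step of the auxiliary model on `ℕ` from `i` under action `a`: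
up with probability `λ/(1-β)`, down (if `i > 0`) with probability `μ_a/(1-β)`, else stay. -/
def auxStep (V : ℕ → ℝ) (a : Rate) (i : ℕ) : ℝ :=
  Q.lam / (1 - Q.beta) * V (i + 1) + Q.rate a / (1 - Q.beta) * V (i - 1)
    + (1 - (Q.lam + Q.rate a) / (1 - Q.beta)) * V i

/-- Value iteration `V'_{β,n}` for the auxiliary model, started at `V'_{β,0} = 0`. -/
def auxVI (H : QState → ℝ) : ℕ → ℕ → ℝ
  | 0, _ => 0
  | n + 1, i =>
      min (Q.auxCost H Rate.slow i + (1 - Q.beta) * Q.auxStep (auxVI H n) Rate.slow i)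
        (Q.auxCost H Rate.fast i + (1 - Q.beta) * Q.auxStep (auxVI H n) Rate.fast i)

/-- The constant `K̃ = g_μ + u_M + β u_M / (1 - η)`. -/
def Ktilde (ζ u : ℝ) : ℝ := Q.gmu + u + Q.beta * u / (1 - Q.eta ζ)

/-- The number `ñ_{ε,k}` of iterations (`0` if the rounded logarithm is negative). -/
def ntilde (ζ u ε : ℝ) (k : ℕ) : ℕ :=
  ⌈Real.logb ((1 - Q.beta) * ζ) (ε * (1 - (1 - Q.beta) * ζ) / (Q.Ktilde ζ u * ζ ^ k))⌉₊

/-- The value `H̃_ε(i,1) = V'_{β,ñ_{ε,k}}(i)`, for `i ≤ k`. -/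
def Htilde (ζ u : ℝ) (H : QState → ℝ) (ε : ℝ) (k i : ℕ) : ℝ :=
  Q.auxVI H (Q.ntilde ζ u ε k) i

/-- The truncation level `k̃_ε`, an integer. -/
def ktilde (ζ u ε : ℝ) : ℤ :=
  ⌈Real.logb (Q.rho * ζ)
    (ε * (1 - Q.eta ζ) * (1 - Q.rho * ζ) / (4 * u * (1 - Q.rho)))⌉

/-- The approximation `s̃_ε(π_μ)`: the sum over `0 ≤ i ≤ k̃_ε` (empty if `k̃_ε < 0`) of
`(1 - ρ_μ) ρ_μ ^ i (H*(i,0) - H̃_{ε/2}(i,1))`. -/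
def approxSavedCost (ζ u : ℝ) (H : QState → ℝ) (ε : ℝ) : ℝ :=
  ∑ i ∈ Finset.range (Q.ktilde ζ u ε + 1).toNat,
    (1 - Q.rho) * Q.rho ^ i
      * (H (i, false) - Q.Htilde ζ u H (ε / 2) (Q.ktilde ζ u ε).toNat i)

end

end QueueModel

namespace QueueModel

noncomputable section

variable (Q : QueueModel)

/-! The weight `M` is a Lyapunov function. When `(0, 0)` is made taboo, one step under any policy
shrinks the `M`-norm by the factor `η < 1` (`abs_pstep_le_eta`, `Admissible.eta_lt_one`). By
`abs_le_of_contraction`, a function that is already `M`-bounded, vanishes at `(0, 0)` and solves a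
one-step equation with data of norm at most `u` has norm at most `u / (1 - η)`; in particular it is
zero when the data vanish. This gives both uniqueness and the explicit error constants.

Existence is built in two layers, since control never returns once lost. Without control, increments
of a function evolve as under the queue with the empty state taboo, so iterates converge
geometrically to the stationary mean (`exists_abs_iterate_fstep_sub_mean_le`). Summing expected
costs minus `g_μ` gives the bias, a solution of the Poisson equation. With this part of `H*` fixed,
loss of control acts as discounting on the controlled states, and value iteration contracts at rate
`(1 - β)ζ` to the other part (`optRel_eq`).

For the saved cost, `X` is stationary and costs `g_μ` on average at each time, so `s^φ(π_μ)` is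
minus the stationary mean of the bias with control. A supersolution argument (`relValue_le_bias`)
bounds every bias below by `H*`, with equality for a minimising policy. Hence `s(π_μ)` is the
stationary mean of `H*(i,0) - H*(i,1)`. Truncating this series and replacing `H*(i,1)` by value
iteration cost at most `ε/2` each. -/

lemma beta_lt_one : Q.beta < 1 := by
  linarith [Q.rates_sum, Q.lam_pos, Q.mu1_pos, Q.mu1_lt_mu2]

lemma mu_pos : 0 < Q.mu := Q.rate_pos Q.base

lemma lam_add_mu_le : Q.lam + Q.mu ≤ 1 := by
  have h : Q.lam + Q.beta + Q.mu ≤ 1 := Q.rate_le Q.base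
  linarith [Q.beta_pos]

lemma mu1_le_rate (a : Rate) : Q.mu1 ≤ Q.rate a := by
  cases a
  · exact le_rfl
  · exact Q.mu1_lt_mu2.le

lemma rateCost_nonneg (a : Rate) : 0 ≤ Q.rateCost a := by
  cases a
  · exact le_rfl
  · exact Q.c2_pos.le

lemma rho_pos : 0 < Q.rho := div_pos Q.lam_pos Q.mu_pos

lemma rho_lt_one : Q.rho < 1 := (div_lt_one Q.mu_pos).2 Q.stable

lemma rho_mul_mu : Q.rho * Q.mu = Q.lam := div_mul_cancel₀ _ Q.mu_pos.ne'

lemma cost_nonneg (φ : Policy) (x : QState) : 0 ≤ Q.cost φ x := by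
  obtain ⟨i, q⟩ := x
  cases q
  · exact add_nonneg (Q.rateCost_nonneg _) (Q.h_nonneg i)
  · exact add_nonneg (Q.rateCost_nonneg _) (Q.h_nonneg i)

lemma gmu_nonneg : 0 ≤ Q.gmu :=
  add_nonneg (Q.rateCost_nonneg _) <| tsum_nonneg fun i =>
    mul_nonneg (Q.h_nonneg i) <|
      mul_nonneg (by linarith [Q.rho_lt_one]) (pow_nonneg Q.rho_pos.le i)

/-! ### The admissible range of the weight parameter -/

section Admissible

variable {Q} {ζ : ℝ} (hζ : Q.Admissible ζ)
include hζ

lemma Admissible.one_lt : 1 < ζ := hζ.1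

lemma Admissible.pos : 0 < ζ := zero_lt_one.trans hζ.1

lemma Admissible.discount_lt_one : (1 - Q.beta) * ζ < 1 := by
  have h1 : 0 < 1 - Q.beta := by linarith [Q.beta_lt_one]
  have := (lt_div_iff₀ h1).1 hζ.2.1
  linarith

lemma Admissible.discount_pos : 0 < (1 - Q.beta) * ζ :=
  mul_pos (by linarith [Q.beta_lt_one]) hζ.pos

lemma Admissible.lam_mul_sub_lt : Q.lam * (ζ - 1) < Q.beta := by
  have h := hζ.2.2.1
  have : ζ - 1 < Q.beta / Q.lam := by linarith
  rw [lt_div_iff₀ Q.lam_pos] at this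
  linarith

lemma Admissible.lam_mul_lt_mu : Q.lam * ζ < Q.mu := by
  rcases hζ.2.2.2 with ⟨_, h2⟩ | ⟨_, h2, _⟩
  · rw [lt_div_iff₀ Q.lam_pos] at h2
    have : Q.mu1 ≤ Q.mu := Q.mu1_le_rate Q.base
    linarith
  · rw [lt_div_iff₀ Q.lam_pos] at h2
    linarith

lemma Admissible.rho_mul_lt_one : Q.rho * ζ < 1 := by
  rw [rho, div_mul_eq_mul_div, div_lt_one Q.mu_pos]
  exact hζ.lam_mul_lt_mu

lemma Admissible.rho_mul_pos : 0 < Q.rho * ζ := mul_pos Q.rho_pos hζ.pos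

lemma Admissible.one_sub_inv_pos : 0 < 1 - 1 / ζ := by
  have : 1 / ζ < 1 := (div_lt_one hζ.pos).2 hζ.one_lt
  linarith

lemma Admissible.lam_mul_sub_eq : Q.lam * (ζ - 1) = (1 - 1 / ζ) * (Q.lam * ζ) := by
  have := hζ.pos.ne'
  field_simp

/-- After multiplication by `ζ` this is a quadratic inequality in `ζ`. If `μ₁ ≤ λ`, admissibility
puts `ζ` below the larger root, and `ζ > 1` puts it above the smaller one. -/
lemma Admissible.lam_mul_sub_lt_slow :
    Q.lam * (ζ - 1) < (1 - 1 / ζ) * Q.mu1 + Q.beta / 2 := by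
  rcases hζ.2.2.2 with ⟨_, h2⟩ | ⟨_, _, h3⟩
  · rw [lt_div_iff₀ Q.lam_pos] at h2
    rw [hζ.lam_mul_sub_eq]
    have := mul_lt_mul_of_pos_left h2 hζ.one_sub_inv_pos
    linarith [Q.beta_pos]
  · rw [lt_div_iff₀ (by linarith [Q.lam_pos])] at h3
    set b := Q.lam + Q.beta / 2 + Q.mu1 with hb
    set r := Real.sqrt (b ^ 2 - 4 * Q.lam * Q.mu1) with hr
    have hl := Q.lam_pos
    have hβ := Q.beta_pos
    have hz := hζ.one_lt
    -- At `1` the quadratic `λζ² - bζ + μ₁` equals `-β/2 < 0`, so `1` lies strictly between the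
    -- roots.
    have hdisc : (2 * Q.lam - b) ^ 2 < b ^ 2 - 4 * Q.lam * Q.mu1 := by
      rw [hb]; nlinarith [mul_pos hl hβ]
    have hnn : 0 ≤ b ^ 2 - 4 * Q.lam * Q.mu1 := (sq_nonneg _).trans hdisc.le
    have hr2 : r ^ 2 = b ^ 2 - 4 * Q.lam * Q.mu1 := Real.sq_sqrt hnn
    have hr0 : 0 ≤ r := Real.sqrt_nonneg _
    have hlow : -r < 2 * Q.lam - b := (abs_lt.1 (abs_lt_of_sq_lt_sq (by rw [hr2]; exact hdisc) hr0)).1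
    have h5 : -r < 2 * Q.lam * ζ - b := by nlinarith
    have h6 : 2 * Q.lam * ζ - b < r := by linarith
    have h7 : (2 * Q.lam * ζ - b) ^ 2 < r ^ 2 := by nlinarith
    rw [hr2] at h7
    have h8 : Q.lam * ζ ^ 2 - b * ζ + Q.mu1 < 0 := by nlinarith
    have h9 : Q.lam * (ζ - 1) * ζ < ((1 - 1 / ζ) * Q.mu1 + Q.beta / 2) * ζ := by
      have : ((1 - 1 / ζ) * Q.mu1 + Q.beta / 2) * ζ = (ζ - 1) * Q.mu1 + Q.beta / 2 * ζ := by
        have := hζ.pos.ne'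
        field_simp
      rw [this]; rw [hb] at h8; nlinarith
    exact lt_of_mul_lt_mul_right h9 hζ.pos.le

/-- The three entries of the maximum are the drifts at `(0, 1)`, at the uncontrolled states and at
`(i, 1)` with `i > 0`; each must outweigh the growth `λ(ζ - 1)` caused by arrivals. -/
lemma Admissible.eta_lt_one : Q.eta ζ < 1 := by
  have h1 := hζ.lam_mul_sub_lt
  have h2 := hζ.lam_mul_sub_lt_slow
  have h3 : Q.lam * (ζ - 1) < (1 - 1 / ζ) * Q.mu := by
    rw [hζ.lam_mul_sub_eq]
    exact mul_lt_mul_of_pos_left hζ.lam_mul_lt_mu hζ.one_sub_inv_pos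
  have h4 : max (-Q.beta)
      (max (-((1 - 1 / ζ) * Q.mu)) (-((1 - 1 / ζ) * Q.mu1) - Q.beta / 2)) < Q.lam - Q.lam * ζ :=
    max_lt (by linarith) (max_lt (by linarith) (by linarith))
  unfold eta
  linarith

omit hζ in
lemma le_eta_control : 1 - Q.lam + Q.lam * ζ - Q.beta ≤ Q.eta ζ := by
  have := le_max_left (-Q.beta)
    (max (-((1 - 1 / ζ) * Q.mu)) (-((1 - 1 / ζ) * Q.mu1) - Q.beta / 2))
  unfold eta
  linarith

omit hζ in
lemma le_eta_free : 1 - Q.lam + Q.lam * ζ - (1 - 1 / ζ) * Q.mu ≤ Q.eta ζ := by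
  have := (le_max_left (-((1 - 1 / ζ) * Q.mu)) (-((1 - 1 / ζ) * Q.mu1) - Q.beta / 2)).trans
    (le_max_right (-Q.beta) _)
  unfold eta
  linarith

omit hζ in
lemma le_eta_slow :
    1 - Q.lam + Q.lam * ζ - (1 - 1 / ζ) * Q.mu1 - Q.beta / 2 ≤ Q.eta ζ := by
  have := (le_max_right (-((1 - 1 / ζ) * Q.mu)) (-((1 - 1 / ζ) * Q.mu1) - Q.beta / 2)).trans
    (le_max_right (-Q.beta) _)
  unfold eta
  linarith

lemma Admissible.eta_pos : 0 < Q.eta ζ := by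
  have h := Q.le_eta_control (ζ := ζ)
  have := mul_pos Q.lam_pos hζ.pos
  linarith [Q.rates_sum, Q.mu1_pos, Q.mu1_lt_mu2]

end Admissible

/-! ### One-step operators -/

/-- One step of the queue with the fixed rate, acting on functions of the queue length. -/
def fstep (f : ℕ → ℝ) (i : ℕ) : ℝ :=
  Q.lam * f (i + 1) + Q.mu * f (i - 1) + (1 - Q.lam - Q.mu) * f i

/-- One step of the controlled queue, killed when control is lost. -/
def cstep (a : Rate) (f : ℕ → ℝ) (i : ℕ) : ℝ :=
  Q.lam * f (i + 1) + Q.rate a * f (i - 1) + (1 - Q.lam - Q.beta - Q.rate a) * f i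

lemma cstep_sub (a : Rate) (f g : ℕ → ℝ) (i : ℕ) :
    Q.cstep a (fun j => f j - g j) i = Q.cstep a f i - Q.cstep a g i := by
  unfold cstep; ring

lemma fstep_sub (f g : ℕ → ℝ) (i : ℕ) :
    Q.fstep (fun j => f j - g j) i = Q.fstep f i - Q.fstep g i := by
  unfold fstep; ring

lemma cstep_mono (a : Rate) {f g : ℕ → ℝ} (h : ∀ i, f i ≤ g i) (i : ℕ) :
    Q.cstep a f i ≤ Q.cstep a g i := by
  have h1 := mul_le_mul_of_nonneg_left (h (i + 1)) Q.lam_pos.le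
  have h2 := mul_le_mul_of_nonneg_left (h (i - 1)) (Q.rate_pos a).le
  have h3 := mul_le_mul_of_nonneg_left (h i)
    (show 0 ≤ 1 - Q.lam - Q.beta - Q.rate a by linarith [Q.rate_le a])
  unfold cstep
  linarith

lemma fstep_mono {f g : ℕ → ℝ} (h : ∀ i, f i ≤ g i) (i : ℕ) : Q.fstep f i ≤ Q.fstep g i := by
  have h1 := mul_le_mul_of_nonneg_left (h (i + 1)) Q.lam_pos.le
  have h2 := mul_le_mul_of_nonneg_left (h (i - 1)) Q.mu_pos.le
  have h3 := mul_le_mul_of_nonneg_left (h i)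
    (show 0 ≤ 1 - Q.lam - Q.mu by linarith [Q.lam_add_mu_le])
  unfold fstep
  linarith

lemma abs_cstep_le_cstep (a : Rate) {f g : ℕ → ℝ} (h : ∀ i, |f i| ≤ g i) (i : ℕ) :
    |Q.cstep a f i| ≤ Q.cstep a g i := by
  refine abs_le.2 ⟨?_, Q.cstep_mono a (fun j => (abs_le.1 (h j)).2) i⟩
  have := Q.cstep_mono a (f := fun j => - g j) (fun j => (abs_le.1 (h j)).1) i
  have e : Q.cstep a (fun j => - g j) i = - Q.cstep a g i := by unfold cstep; ring
  linarith

lemma abs_fstep_le_fstep {f g : ℕ → ℝ} (h : ∀ i, |f i| ≤ g i) (i : ℕ) :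
    |Q.fstep f i| ≤ Q.fstep g i := by
  refine abs_le.2 ⟨?_, Q.fstep_mono (fun j => (abs_le.1 (h j)).2) i⟩
  have := Q.fstep_mono (f := fun j => - g j) (fun j => (abs_le.1 (h j)).1) i
  have e : Q.fstep (fun j => - g j) i = - Q.fstep g i := by unfold fstep; ring
  linarith

/-! ### Weighted norm estimates for one step -/

section Weighted

variable {Q} {ζ : ℝ} (hζ : Q.Admissible ζ) {f : ℕ → ℝ} {C : ℝ}
include hζ

omit hζ in
lemma cstep_weight_zero (a : Rate) (C : ℝ) :
    Q.cstep a (fun j => C * ζ ^ j) 0 = (1 - Q.lam + Q.lam * ζ - Q.beta) * (C * ζ ^ 0) := by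
  simp [cstep]; ring

lemma cstep_weight_succ (a : Rate) (C : ℝ) (i : ℕ) :
    Q.cstep a (fun j => C * ζ ^ j) (i + 1) =
      (1 - Q.lam + Q.lam * ζ - Q.beta - (1 - 1 / ζ) * Q.rate a) * (C * ζ ^ (i + 1)) := by
  have := hζ.pos.ne'
  simp only [cstep, Nat.add_sub_cancel, pow_succ]
  field_simp
  ring

lemma cstep_weight_le (a : Rate) (hC : 0 ≤ C) (i : ℕ) :
    Q.cstep a (fun j => C * ζ ^ j) i ≤ (1 - Q.lam + Q.lam * ζ - Q.beta) * (C * ζ ^ i) := by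
  cases i with
  | zero => exact (cstep_weight_zero a C).le
  | succ i =>
    rw [cstep_weight_succ hζ]
    refine mul_le_mul_of_nonneg_right ?_ (mul_nonneg hC (pow_nonneg hζ.pos.le _))
    have := mul_pos hζ.one_sub_inv_pos (Q.rate_pos a)
    linarith

lemma fstep_weight_succ (C : ℝ) (i : ℕ) :
    Q.fstep (fun j => C * ζ ^ j) (i + 1) =
      (1 - Q.lam + Q.lam * ζ - (1 - 1 / ζ) * Q.mu) * (C * ζ ^ (i + 1)) := by
  have := hζ.pos.ne'
  simp only [fstep, Nat.add_sub_cancel, pow_succ]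
  field_simp
  ring

lemma abs_cstep_le_eta (a : Rate) (hC : 0 ≤ C) (hf : ∀ i, |f i| ≤ C * ζ ^ i) (i : ℕ) :
    |Q.cstep a f i| ≤ Q.eta ζ * (C * ζ ^ i) :=
  ((Q.abs_cstep_le_cstep a hf i).trans (cstep_weight_le hζ a hC i)).trans <|
    mul_le_mul_of_nonneg_right Q.le_eta_control (mul_nonneg hC (pow_nonneg hζ.pos.le _))

lemma abs_cstep_le_discount (a : Rate) (hC : 0 ≤ C) (hf : ∀ i, |f i| ≤ C * ζ ^ i) (i : ℕ) :
    |Q.cstep a f i| ≤ (1 - Q.beta) * ζ * (C * ζ ^ i) := by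
  refine ((Q.abs_cstep_le_cstep a hf i).trans (cstep_weight_le hζ a hC i)).trans <|
    mul_le_mul_of_nonneg_right ?_ (mul_nonneg hC (pow_nonneg hζ.pos.le _))
  -- The two factors differ by `(1 - β - λ)(ζ - 1)`.
  have h1 : 0 < 1 - Q.beta - Q.lam := by
    linarith [Q.rates_sum, Q.mu1_pos, Q.mu1_lt_mu2]
  nlinarith [hζ.one_lt]

/-- Contraction of the uncontrolled queue when the empty state is taboo. -/
lemma abs_fstep_le_eta (hC : 0 ≤ C) (h0 : f 0 = 0) (hf : ∀ i, |f i| ≤ C * ζ ^ i) (i : ℕ) :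
    |Q.fstep f i| ≤ Q.eta ζ * (C * ζ ^ i) := by
  cases i with
  | zero =>
    have h1 : |Q.fstep f 0| = Q.lam * |f 1| := by
      simp [fstep, h0, abs_mul, abs_of_pos Q.lam_pos]
    have h2 := mul_le_mul_of_nonneg_left (hf 1) Q.lam_pos.le
    -- In the empty state only the arrival term survives, because `f 0 = 0`.
    have h3 : Q.lam * ζ ≤ Q.eta ζ := by
      linarith [Q.le_eta_control (ζ := ζ), Q.rates_sum, Q.mu1_pos, Q.mu1_lt_mu2]
    have h4 := mul_le_mul_of_nonneg_right h3 hC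
    rw [h1, pow_zero, mul_one]
    rw [pow_one] at h2
    linarith
  | succ i =>
    refine (Q.abs_fstep_le_fstep hf (i + 1)).trans ?_
    rw [fstep_weight_succ hζ]
    exact mul_le_mul_of_nonneg_right Q.le_eta_free (mul_nonneg hC (pow_nonneg hζ.pos.le _))

lemma abs_fstep_le (hC : 0 ≤ C) (hf : ∀ i, |f i| ≤ C * ζ ^ i) (i : ℕ) :
    |Q.fstep f i| ≤ ζ * C * ζ ^ i := by
  have hz := hζ.one_lt
  have h0 : 0 ≤ C * ζ ^ i := mul_nonneg hC (pow_nonneg hζ.pos.le _)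
  have h1 : C * ζ ^ (i - 1) ≤ ζ * (C * ζ ^ i) :=
    (mul_le_mul_of_nonneg_left (pow_le_pow_right₀ hz.le (Nat.sub_le i 1)) hC).trans
      (le_mul_of_one_le_left h0 hz.le)
  have h2 : C * ζ ^ i ≤ ζ * (C * ζ ^ i) := le_mul_of_one_le_left h0 hz.le
  have h3 : C * ζ ^ (i + 1) = ζ * (C * ζ ^ i) := by ring
  refine (Q.abs_fstep_le_fstep hf i).trans ?_
  have h4 := mul_le_mul_of_nonneg_left h1 Q.mu_pos.le
  have h5 := mul_le_mul_of_nonneg_left h2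
    (show 0 ≤ 1 - Q.lam - Q.mu by linarith [Q.lam_add_mu_le])
  simp only [fstep, h3]
  linarith

end Weighted

/-- A function bounded by a multiple of a weight is bounded by the fixed point of a contraction
that improves every such bound. -/
lemma abs_le_of_contraction {α : Type*} {F M : α → ℝ} {u η C : ℝ} (hM : ∀ x, 0 ≤ M x) (hη0 : 0 ≤ η) (hη : η < 1)
    (hu : 0 ≤ u) (hC0 : 0 ≤ C) (hC : ∀ x, |F x| ≤ C * M x)
    (step : ∀ C, 0 ≤ C → (∀ x, |F x| ≤ C * M x) → ∀ x, |F x| ≤ (u + η * C) * M x) (x : α) :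
    |F x| ≤ u / (1 - η) * M x := by
  have h1 : 0 < 1 - η := by linarith
  have hL : 0 ≤ u / (1 - η) := div_nonneg hu h1.le
  -- Since `u / (1 - η)` is fixed by `C ↦ u + η * C`, each round multiplies only the excess over it
  -- by `η`.
  have key : ∀ n : ℕ, ∀ x, |F x| ≤ (u / (1 - η) + η ^ n * C) * M x := by
    intro n
    induction n with
    | zero =>
      intro x
      have := mul_nonneg hL (hM x)
      rw [pow_zero, one_mul, add_mul]
      linarith [hC x]
    | succ n ih =>
      intro x
      refine (step _ (add_nonneg hL (mul_nonneg (pow_nonneg hη0 n) hC0)) ih x).trans (le_of_eq ?_)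
      congr 1
      field_simp
      ring
  have ht : Filter.Tendsto (fun n : ℕ => (u / (1 - η) + η ^ n * C) * M x) Filter.atTop
      (nhds ((u / (1 - η) + 0 * C) * M x)) :=
    ((((tendsto_pow_atTop_nhds_zero_of_lt_one hη0 hη).mul_const C).const_add _).mul_const _)
  have := ge_of_tendsto' ht fun n => key n x
  simpa using this

/-! ### The stationary law of the uncontrolled queue -/

/-- The stationary probability of `i` customers. -/
def statProb (i : ℕ) : ℝ := (1 - Q.rho) * Q.rho ^ i

lemma statProb_nonneg (i : ℕ) : 0 ≤ Q.statProb i :=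
  mul_nonneg (by linarith [Q.rho_lt_one]) (pow_nonneg Q.rho_pos.le i)

lemma hasSum_statProb : HasSum Q.statProb 1 := by
  have h := (hasSum_geometric_of_lt_one Q.rho_pos.le Q.rho_lt_one).mul_left (1 - Q.rho)
  rwa [mul_inv_cancel₀ (by linarith [Q.rho_lt_one])] at h

lemma mu_mul_statProb_succ (i : ℕ) : Q.mu * Q.statProb (i + 1) = Q.lam * Q.statProb i := by
  rw [← Q.rho_mul_mu]; unfold statProb; ring

section Weighted

variable {Q} {ζ : ℝ} (hζ : Q.Admissible ζ) {f : ℕ → ℝ} {C : ℝ}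
include hζ

lemma summable_statProb_weight : Summable fun i => Q.statProb i * ζ ^ i := by
  have h := (summable_geometric_of_lt_one hζ.rho_mul_pos.le hζ.rho_mul_lt_one).mul_left (1 - Q.rho)
  refine h.congr fun i => ?_
  rw [statProb, mul_pow, mul_assoc]

omit hζ in
lemma norm_statProb_mul_le (hf : ∀ i, |f i| ≤ C * ζ ^ i) (i : ℕ) :
    ‖Q.statProb i * f i‖ ≤ C * (Q.statProb i * ζ ^ i) := by
  rw [Real.norm_eq_abs, abs_mul, abs_of_nonneg (Q.statProb_nonneg i)]
  have := mul_le_mul_of_nonneg_left (hf i) (Q.statProb_nonneg i)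
  linarith

lemma summable_statProb_mul (hf : ∀ i, |f i| ≤ C * ζ ^ i) :
    Summable fun i => Q.statProb i * f i :=
  Summable.of_norm_bounded ((summable_statProb_weight hζ).mul_left C)
    (norm_statProb_mul_le hf)

lemma abs_tsum_statProb_mul_le (hf : ∀ i, |f i| ≤ C * ζ ^ i) :
    |∑' i, Q.statProb i * f i| ≤ C * ∑' i, Q.statProb i * ζ ^ i := by
  rw [← tsum_mul_left]
  exact tsum_of_norm_bounded ((summable_statProb_weight hζ).mul_left C).hasSum
    (norm_statProb_mul_le hf)

/-- Detailed balance telescopes the partial sums of the difference to the flux `λ π(n) (f(n+1) -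
f(n))` across one edge, which tends to zero. -/
lemma tsum_statProb_mul_fstep (hC : 0 ≤ C) (hf : ∀ i, |f i| ≤ C * ζ ^ i) :
    ∑' i, Q.statProb i * Q.fstep f i = ∑' i, Q.statProb i * f i := by
  have hd : ∀ i, |f (i + 1) - f i| ≤ (C * (ζ + 1)) * ζ ^ i := fun i => by
    refine (abs_sub _ _).trans ?_
    have h1 := hf (i + 1)
    have h2 := hf i
    rw [pow_succ] at h1
    linarith
  have hs := (summable_statProb_mul hζ (abs_fstep_le hζ hC hf)).sub (summable_statProb_mul hζ hf)
  have hp : ∀ n, ∑ i ∈ Finset.range (n + 1), (Q.statProb i * Q.fstep f i - Q.statProb i * f i) =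
      Q.lam * (Q.statProb n * (f (n + 1) - f n)) := by
    intro n
    induction n with
    | zero => simp [fstep]; ring
    | succ n ih =>
      rw [Finset.sum_range_succ, ih]
      have h := Q.mu_mul_statProb_succ n
      simp only [fstep, Nat.add_sub_cancel]
      linear_combination (f n - f (n + 1)) * h
  have h1 := (Filter.tendsto_add_atTop_iff_nat 1).2 hs.hasSum.tendsto_sum_nat
  have h2 := (summable_statProb_mul hζ hd).tendsto_atTop_zero.const_mul Q.lam
  rw [mul_zero] at h2
  have h3 := tendsto_nhds_unique (h1.congr hp) h2
  rw [Summable.tsum_sub (summable_statProb_mul hζ (abs_fstep_le hζ hC hf))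
    (summable_statProb_mul hζ hf)] at h3
  linarith

/-! ### Geometric ergodicity of the uncontrolled queue -/

/-- The increments of `f` are contracted by a step of the uncontrolled queue. -/
lemma abs_fstep_increment_le (hC : 0 ≤ C) (hf : ∀ i, |f (i + 1) - f i| ≤ C * ζ ^ i) (i : ℕ) :
    |Q.fstep f (i + 1) - Q.fstep f i| ≤ Q.eta ζ * C * ζ ^ i := by
  -- Shifting the increments by one place and setting `d 0 = 0` turns their recursion into `fstep`
  -- with the empty state taboo; the shift accounts for `C / ζ`.
  let d : ℕ → ℝ := fun i => match i with
    | 0 => 0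
    | i + 1 => f (i + 1) - f i
  have hd : ∀ j, |d j| ≤ C / ζ * ζ ^ j := by
    intro j
    cases j with
    | zero =>
      simp only [d, abs_zero, pow_zero, mul_one]
      exact div_nonneg hC hζ.pos.le
    | succ j =>
      have := hζ.pos.ne'
      rw [show C / ζ * ζ ^ (j + 1) = C * ζ ^ j by rw [pow_succ]; field_simp]
      exact hf j
  have h := abs_fstep_le_eta hζ (div_nonneg hC hζ.pos.le) rfl hd (i + 1)
  have e1 : Q.fstep d (i + 1) = Q.fstep f (i + 1) - Q.fstep f i := by
    cases i with
    | zero => simp [fstep, d]; ring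
    | succ i => simp [fstep, d]; ring
  have e2 : Q.eta ζ * (C / ζ * ζ ^ (i + 1)) = Q.eta ζ * C * ζ ^ i := by
    have := hζ.pos.ne'
    rw [pow_succ]; field_simp
  rwa [e1, e2] at h

lemma abs_iterate_fstep_increment_le (hC : 0 ≤ C) (hf : ∀ i, |f (i + 1) - f i| ≤ C * ζ ^ i)
    (n i : ℕ) : |Q.fstep^[n] f (i + 1) - Q.fstep^[n] f i| ≤ C * Q.eta ζ ^ n * ζ ^ i := by
  induction n generalizing i with
  | zero => simpa using hf i
  | succ n ih =>
    rw [Function.iterate_succ_apply']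
    refine (abs_fstep_increment_le hζ (mul_nonneg hC (pow_nonneg hζ.eta_pos.le n)) ih i).trans
      (le_of_eq ?_)
    ring

lemma abs_sub_zero_le_of_increment (hC : 0 ≤ C) (hf : ∀ i, |f (i + 1) - f i| ≤ C * ζ ^ i)
    (i : ℕ) : |f i - f 0| ≤ C / (ζ - 1) * ζ ^ i := by
  have hz : 0 < ζ - 1 := by linarith [hζ.one_lt]
  induction i with
  | zero => simpa using div_nonneg hC hz.le
  | succ i ih =>
    have h1 := abs_add_le (f (i + 1) - f i) (f i - f 0)
    rw [sub_add_sub_cancel] at h1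
    have h2 : C / (ζ - 1) * ζ ^ (i + 1) = C * ζ ^ i + C / (ζ - 1) * ζ ^ i := by
      rw [pow_succ]; field_simp; ring
    linarith [hf i]

lemma abs_sub_mean_le_of_increment (hC : 0 ≤ C) (hf : ∀ i, |f (i + 1) - f i| ≤ C * ζ ^ i)
    (i : ℕ) : |f i - ∑' j, Q.statProb j * f j| ≤
      C / (ζ - 1) * (1 + ∑' j, Q.statProb j * ζ ^ j) * ζ ^ i := by
  have hz : 0 < ζ - 1 := by linarith [hζ.one_lt]
  have h0 := abs_sub_zero_le_of_increment hζ hC hf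
  have h1 := abs_tsum_statProb_mul_le hζ h0
  have hs := summable_statProb_mul hζ h0
  have h2 : ∑' j, Q.statProb j * f j = ∑' j, Q.statProb j * (f j - f 0) + f 0 := by
    have h := hs.hasSum.add (Q.hasSum_statProb.mul_right (f 0))
    rw [one_mul] at h
    rw [← h.tsum_eq]
    congr 1; ext j; ring
  have h3 : f i - ∑' j, Q.statProb j * f j =
      (f i - f 0) - ∑' j, Q.statProb j * (f j - f 0) := by rw [h2]; ring
  have h4 : 0 ≤ C / (ζ - 1) * ∑' j, Q.statProb j * ζ ^ j := (abs_nonneg _).trans h1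
  have h5 := le_mul_of_one_le_right h4 (one_le_pow₀ hζ.one_lt.le (n := i))
  rw [h3]
  refine (abs_sub _ _).trans ?_
  have := h0 i
  linarith

/-- Increments decay like `η ^ n` while the stationary mean is preserved, so the iterates flatten
out to that mean. -/
lemma exists_abs_iterate_fstep_sub_mean_le (hC : 0 ≤ C) (hf : ∀ i, |f i| ≤ C * ζ ^ i) :
    ∃ K, 0 ≤ K ∧ ∀ n i, |Q.fstep^[n] f i - ∑' j, Q.statProb j * f j| ≤
      K * Q.eta ζ ^ n * ζ ^ i := by
  have hz : 0 < ζ - 1 := by linarith [hζ.one_lt]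
  have hd : ∀ i, |f (i + 1) - f i| ≤ (C * (ζ + 1)) * ζ ^ i := fun i => by
    refine (abs_sub _ _).trans ?_
    have h1 := hf (i + 1)
    have h2 := hf i
    rw [pow_succ] at h1
    linarith
  have hC' : 0 ≤ C * (ζ + 1) := mul_nonneg hC (by linarith)
  have hb : ∀ n, ∃ B, 0 ≤ B ∧ ∀ i, |Q.fstep^[n] f i| ≤ B * ζ ^ i := by
    intro n
    induction n with
    | zero => exact ⟨C, hC, hf⟩
    | succ n ih =>
      obtain ⟨B, hB, h⟩ := ih
      refine ⟨ζ * B, mul_nonneg hζ.pos.le hB, fun i => ?_⟩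
      rw [Function.iterate_succ_apply']
      exact abs_fstep_le hζ hB h i
  have hm : ∀ n, ∑' j, Q.statProb j * Q.fstep^[n] f j = ∑' j, Q.statProb j * f j := by
    intro n
    induction n with
    | zero => rfl
    | succ n ih =>
      obtain ⟨B, hB, h⟩ := hb n
      rw [← ih, Function.iterate_succ_apply', tsum_statProb_mul_fstep hζ hB h]
  have hS : 0 ≤ ∑' j, Q.statProb j * ζ ^ j :=
    tsum_nonneg fun j => mul_nonneg (Q.statProb_nonneg j) (pow_nonneg hζ.pos.le j)
  refine ⟨C * (ζ + 1) / (ζ - 1) * (1 + ∑' j, Q.statProb j * ζ ^ j), by positivity, fun n i => ?_⟩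
  have h := abs_sub_mean_le_of_increment hζ (mul_nonneg hC' (pow_nonneg hζ.eta_pos.le n))
    (abs_iterate_fstep_increment_le hζ hC' hd n) i
  rw [hm n] at h
  refine h.trans (le_of_eq ?_)
  ring

/-! ### Cost bounds -/

/-- Each term of the convergent series `∑ h(i) ζ⁻ⁱ` is at most its sum. -/
lemma exists_h_le : ∃ C, 0 ≤ C ∧ ∀ i, Q.h i ≤ C * ζ ^ i := by
  have hs := Q.h_summable ζ⁻¹ (inv_pos.2 hζ.pos) (inv_lt_one_of_one_lt₀ hζ.one_lt)
  have hn : ∀ i, 0 ≤ Q.h i * ζ⁻¹ ^ i := fun i =>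
    mul_nonneg (Q.h_nonneg i) (pow_nonneg (inv_pos.2 hζ.pos).le i)
  refine ⟨∑' i, Q.h i * ζ⁻¹ ^ i, tsum_nonneg hn, fun i => ?_⟩
  have h := hs.le_tsum i fun j _ => hn j
  have hp : 0 < ζ ^ i := pow_pos hζ.pos i
  have := mul_le_mul_of_nonneg_right h hp.le
  rwa [inv_pow, mul_assoc, inv_mul_cancel₀ hp.ne', mul_one] at this

omit hζ in
lemma weight_nonneg (hz : 0 ≤ ζ) (x : QState) : 0 ≤ weight ζ x := by
  obtain ⟨i, q⟩ := x
  cases q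
  · exact div_nonneg (pow_nonneg hz i) (by norm_num)
  · exact pow_nonneg hz i

lemma half_pow_le_weight (x : QState) : ζ ^ x.1 / 2 ≤ weight ζ x := by
  have := pow_pos hζ.pos x.1
  obtain ⟨i, q⟩ := x
  cases q
  · exact le_rfl
  · simp only [weight] at *; linarith

lemma weight_le_pow (x : QState) : weight ζ x ≤ ζ ^ x.1 := by
  have := pow_pos hζ.pos x.1
  obtain ⟨i, q⟩ := x
  cases q
  · simp only [weight] at *; linarith
  · exact le_rfl

lemma exists_isCostBound : ∃ u, Q.IsCostBound ζ u := by
  obtain ⟨C, hC, hh⟩ := exists_h_le hζ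
  have hg := Q.gmu_nonneg
  have hr : ∀ a, Q.rateCost a ≤ Q.c2 := by
    intro a
    cases a
    · exact Q.c2_pos.le
    · exact le_rfl
  have hc2 := Q.c2_pos
  -- The factor `2` compensates the halved weight of the uncontrolled states.
  have key : ∀ (x : QState) (c : ℝ), 0 ≤ c → c ≤ Q.c2 + Q.gmu + C * ζ ^ x.1 →
      |c| ≤ 2 * (Q.c2 + Q.gmu + C) * weight ζ x := by
    intro x c h0 hc
    rw [abs_of_nonneg h0]
    have h1 : 1 ≤ ζ ^ x.1 := one_le_pow₀ hζ.one_lt.le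
    have h2 := mul_le_mul_of_nonneg_left (half_pow_le_weight hζ x)
      (show 0 ≤ 2 * (Q.c2 + Q.gmu + C) by linarith)
    nlinarith
  refine ⟨2 * (Q.c2 + Q.gmu + C), fun φ x => key x _ (Q.cost_nonneg φ x) ?_, fun x => key x _ hg ?_⟩
  · obtain ⟨i, q⟩ := x
    cases q
    · have : Q.cmu ≤ Q.c2 := hr _
      have := hh i
      simp only [cost]; linarith
    · have := hr (φ i)
      have := hh i
      simp only [cost]; linarith
  · have := mul_nonneg hC (pow_nonneg hζ.pos.le x.1)
    linarith

omit hζ in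
lemma IsCostBound.pos {u : ℝ} (hu : Q.IsCostBound ζ u) : 0 < u := by
  have h := hu.1 (fun _ => Rate.fast) (0, true)
  have e : Q.cost (fun _ => Rate.fast) (0, true) = Q.c2 := by
    simp [cost, Q.h_zero, QueueData.rateCost]
  rw [e, abs_of_pos Q.c2_pos] at h
  simpa [weight] using Q.c2_pos.trans_le h

omit hζ in
-- Both quantities are nonnegative, so their difference is bounded by the larger one and the
-- constant stays `u` instead of `2u`.
lemma IsCostBound.abs_cost_sub_le {u : ℝ} (hu : Q.IsCostBound ζ u) (φ : Policy) (x : QState) :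
    |Q.cost φ x - Q.gmu| ≤ u * weight ζ x := by
  have h1 := hu.1 φ x
  have h2 := hu.2 x
  have h3 := Q.cost_nonneg φ x
  have h4 := Q.gmu_nonneg
  rw [abs_of_nonneg h3] at h1
  rw [abs_of_nonneg h4] at h2
  exact abs_le.2 ⟨by linarith, by linarith⟩

lemma tsum_statProb_mul_cost : ∑' i, Q.statProb i * (Q.cmu + Q.h i) = Q.gmu := by
  obtain ⟨C, hC, hh⟩ := exists_h_le hζ
  have hs : Summable fun i => Q.statProb i * Q.h i :=
    summable_statProb_mul hζ fun i => by rw [abs_of_nonneg (Q.h_nonneg i)]; exact hh i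
  have h := (Q.hasSum_statProb.mul_right Q.cmu).add hs.hasSum
  rw [one_mul] at h
  simp_rw [mul_add]
  rw [h.tsum_eq, gmu]
  congr 2
  ext i
  rw [mul_comm, statProb]

end Weighted

/-! ### Expected relative costs under a fixed policy -/

/-- One step of the chain with policy `φ`, acting on functions of the state. -/
def pstep (φ : Policy) (F : QState → ℝ) : QState → ℝ
  | (i, true) => Q.cstep (φ i) (fun j => F (j, true)) i + Q.beta * F (i, false)
  | (i, false) => Q.fstep (fun j => F (j, false)) i

lemma pstep_false (φ : Policy) (F : QState → ℝ) (i : ℕ) :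
    Q.pstep φ F (i, false) = Q.fstep (fun j => F (j, false)) i := rfl

lemma pstep_true (φ : Policy) (F : QState → ℝ) (i : ℕ) :
    Q.pstep φ F (i, true) = Q.cstep (φ i) (fun j => F (j, true)) i + Q.beta * F (i, false) := rfl

lemma pstep_sub (φ : Policy) (F G : QState → ℝ) (x : QState) :
    Q.pstep φ (fun y => F y - G y) x = Q.pstep φ F x - Q.pstep φ G x := by
  obtain ⟨i, q⟩ := x
  cases q
  · simp only [pstep_false, fstep_sub]
  · simp only [pstep_true, cstep_sub]; ring

lemma pstep_const (φ : Policy) (c : ℝ) (x : QState) : Q.pstep φ (fun _ => c) x = c := by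
  obtain ⟨i, q⟩ := x
  cases q
  · simp only [pstep_false, fstep]; ring
  · simp only [pstep_true, cstep]; ring

lemma integral_stepLaw (φ : Policy) (F : QState → ℝ) (x : QState) :
    ∫ y, F y ∂(Q.stepLaw φ x) = Q.pstep φ F x := by
  have hd : ∀ (c : ℝ) (y : QState),
      Integrable F (ENNReal.ofReal c • Measure.dirac y) := fun c y =>
    (integrable_dirac (by finiteness)).smul_measure ENNReal.ofReal_ne_top
  have h1 := Q.lam_pos.le
  have h2 := Q.beta_pos.le
  obtain ⟨i, q⟩ := x
  cases q
  · have h3 := Q.mu_pos.le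
    have h4 := Q.lam_add_mu_le
    simp only [stepLaw]
    rw [integral_add_measure ((hd _ _).add_measure (hd _ _)) (hd _ _),
      integral_add_measure (hd _ _) (hd _ _)]
    simp only [integral_smul_measure, integral_dirac, smul_eq_mul, pstep_false, fstep,
      ENNReal.toReal_ofReal h1, ENNReal.toReal_ofReal h3,
      ENNReal.toReal_ofReal (show 0 ≤ 1 - Q.lam - Q.mu by linarith)]
  · have h3 := (Q.rate_pos (φ i)).le
    have h4 := Q.rate_le (φ i)
    simp only [stepLaw]
    rw [integral_add_measure (((hd _ _).add_measure (hd _ _)).add_measure (hd _ _)) (hd _ _),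
      integral_add_measure ((hd _ _).add_measure (hd _ _)) (hd _ _),
      integral_add_measure (hd _ _) (hd _ _)]
    simp only [integral_smul_measure, integral_dirac, smul_eq_mul, pstep_true, cstep,
      ENNReal.toReal_ofReal h1, ENNReal.toReal_ofReal h2, ENNReal.toReal_ofReal h3,
      ENNReal.toReal_ofReal (show 0 ≤ 1 - Q.lam - Q.beta - Q.rate (φ i) by linarith)]
    ring

lemma integrable_stepLaw (φ : Policy) (F : QState → ℝ) (x : QState) :
    Integrable F (Q.stepLaw φ x) := by
  have hd : ∀ (c : ℝ) (y : QState),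
      Integrable F (ENNReal.ofReal c • Measure.dirac y) := fun c y =>
    (integrable_dirac (by finiteness)).smul_measure ENNReal.ofReal_ne_top
  obtain ⟨i, q⟩ := x
  cases q
  · exact ((hd _ _).add_measure (hd _ _)).add_measure (hd _ _)
  · exact (((hd _ _).add_measure (hd _ _)).add_measure (hd _ _)).add_measure (hd _ _)

lemma hasSum_pstep (φ : Policy) {F : ℕ → QState → ℝ} {G : QState → ℝ}
    (h : ∀ x, HasSum (fun n => F n x) (G x)) (x : QState) :
    HasSum (fun n => Q.pstep φ (F n) x) (Q.pstep φ G x) := by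
  obtain ⟨i, q⟩ := x
  cases q
  · exact (((h _).mul_left _).add ((h _).mul_left _)).add ((h _).mul_left _)
  · exact ((((h _).mul_left _).add ((h _).mul_left _)).add ((h _).mul_left _)).add
      ((h _).mul_left _)

lemma iterate_pstep_false (φ : Policy) (F : QState → ℝ) (n i : ℕ) :
    (Q.pstep φ)^[n] F (i, false) = Q.fstep^[n] (fun j => F (j, false)) i := by
  induction n generalizing i with
  | zero => rfl
  | succ n ih =>
    rw [Function.iterate_succ_apply', Function.iterate_succ_apply', pstep_false]
    simp_rw [ih]

/-- The expected cost after `n` steps under the policy `φ`, relative to the average cost. -/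
def relCost (φ : Policy) (n : ℕ) : QState → ℝ :=
  (Q.pstep φ)^[n] fun x => Q.cost φ x - Q.gmu

lemma relCost_zero (φ : Policy) (x : QState) : Q.relCost φ 0 x = Q.cost φ x - Q.gmu := rfl

lemma relCost_succ (φ : Policy) (n : ℕ) : Q.relCost φ (n + 1) = Q.pstep φ (Q.relCost φ n) :=
  Function.iterate_succ_apply' _ _ _

/-- The expected total relative cost under the policy `φ`. -/
def bias (φ : Policy) (x : QState) : ℝ := ∑' n, Q.relCost φ n x

lemma relCost_false (φ ψ : Policy) (n i : ℕ) :
    Q.relCost φ n (i, false) = Q.relCost ψ n (i, false) := by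
  rw [relCost, relCost, iterate_pstep_false, iterate_pstep_false]
  rfl

/-- The uncontrolled states are closed and offer no choice; this makes the policy used in `freeRel`
immaterial. -/
lemma bias_false (φ ψ : Policy) (i : ℕ) : Q.bias φ (i, false) = Q.bias ψ (i, false) :=
  tsum_congr fun n => Q.relCost_false φ ψ n i

section Weighted

variable {Q} {ζ : ℝ} (hζ : Q.Admissible ζ)
include hζ

lemma abs_pstep_le (φ : Policy) {F : QState → ℝ} {C : ℝ} (hC : 0 ≤ C)
    (hF : ∀ x, |F x| ≤ C * ζ ^ x.1) (x : QState) : |Q.pstep φ F x| ≤ ζ * C * ζ ^ x.1 := by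
  obtain ⟨i, q⟩ := x
  cases q
  · exact abs_fstep_le hζ hC (fun i => hF (i, false)) i
  · have h1 := abs_cstep_le_discount hζ (φ i) hC (fun i => hF (i, true)) i
    have hβ := Q.beta_pos
    have h2 : |Q.beta * F (i, false)| ≤ Q.beta * (C * ζ ^ i) := by
      rw [abs_mul, abs_of_pos hβ]
      exact mul_le_mul_of_nonneg_left (hF (i, false)) hβ.le
    have h3 : 0 ≤ Q.beta * (ζ - 1) * (C * ζ ^ i) :=
      mul_nonneg (mul_nonneg hβ.le (by linarith [hζ.one_lt]))
        (mul_nonneg hC (pow_nonneg hζ.pos.le i))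
    rw [pstep_true]
    refine (abs_add_le _ _).trans ?_
    simp only
    linarith

lemma tsum_statProb_mul_relCost_false (φ : Policy) (n : ℕ) :
    ∑' i, Q.statProb i * Q.relCost φ n (i, false) = 0 := by
  obtain ⟨u, hu⟩ := exists_isCostBound hζ
  have hu0 := hu.pos
  have key : ∀ n, (∃ B, 0 ≤ B ∧ ∀ i, |Q.relCost φ n (i, false)| ≤ B * ζ ^ i) ∧
      ∑' i, Q.statProb i * Q.relCost φ n (i, false) = 0 := by
    intro n
    induction n with
    | zero =>
      refine ⟨⟨u, hu0.le, fun i => ?_⟩, ?_⟩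
      · exact (hu.abs_cost_sub_le φ (i, false)).trans
          (mul_le_mul_of_nonneg_left (weight_le_pow hζ (i, false)) hu0.le)
      · have h : Summable fun i => Q.statProb i * (Q.cmu + Q.h i) :=
          summable_statProb_mul hζ (C := u) fun i => (hu.1 φ (i, false)).trans
            (mul_le_mul_of_nonneg_left (weight_le_pow hζ (i, false)) hu0.le)
        have h2 := h.hasSum.sub (Q.hasSum_statProb.mul_right Q.gmu)
        rw [tsum_statProb_mul_cost hζ, one_mul, sub_self] at h2
        rw [← h2.tsum_eq]
        refine tsum_congr fun i => ?_
        rw [relCost_zero, cost]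
        ring
    | succ n ih =>
      obtain ⟨⟨B, hB, h⟩, h0⟩ := ih
      rw [relCost_succ]
      exact ⟨⟨ζ * B, mul_nonneg hζ.pos.le hB, abs_fstep_le hζ hB h⟩,
        (tsum_statProb_mul_fstep hζ hB h).trans h0⟩
  exact (key n).2

/-- Without control, ergodicity and the zero stationary mean give decay `K η ^ n`. With control, a
bound `a n` obeys `a (n+1) ≤ η a n + β K η ^ n`. -/
lemma exists_abs_relCost_le (φ : Policy) :
    ∃ K θ, 0 ≤ K ∧ 0 ≤ θ ∧ θ < 1 ∧ ∀ n x, |Q.relCost φ n x| ≤ K * θ ^ n * ζ ^ x.1 := by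
  obtain ⟨u, hu⟩ := exists_isCostBound hζ
  have hu0 := hu.pos
  have hb : ∀ x, |Q.relCost φ 0 x| ≤ u * ζ ^ x.1 := fun x =>
    (hu.abs_cost_sub_le φ x).trans (mul_le_mul_of_nonneg_left (weight_le_pow hζ x) hu0.le)
  obtain ⟨K, hK, hw⟩ := exists_abs_iterate_fstep_sub_mean_le hζ hu0.le fun i => hb (i, false)
  have hw' : ∀ n i, |Q.relCost φ n (i, false)| ≤ K * Q.eta ζ ^ n * ζ ^ i := by
    intro n i
    have h := hw n i
    rw [tsum_statProb_mul_relCost_false hζ, sub_zero] at h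
    rw [relCost, iterate_pstep_false]
    exact h
  have hη := hζ.eta_lt_one
  have hη0 := hζ.eta_pos
  -- The forcing has the same rate `η` as the recursion, which could produce `n η ^ n`; a slightly
  -- larger rate absorbs it.
  obtain ⟨θ, h1, h2⟩ := exists_between hη
  have hθ0 : 0 < θ := hη0.trans h1
  have hβ := Q.beta_pos
  have hd : 0 < θ - Q.eta ζ := by linarith
  have hKβ : 0 ≤ Q.beta * K / (θ - Q.eta ζ) := by positivity
  -- The summands cover the initial bound, the uncontrolled bound, and the requirement `η A + β K ≤
  -- θ A`.
  set A := u + K + Q.beta * K / (θ - Q.eta ζ) with hA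
  have hA0 : 0 ≤ A := by positivity
  have hstep : Q.eta ζ * A + Q.beta * K ≤ A * θ := by
    have : Q.beta * K = Q.beta * K / (θ - Q.eta ζ) * (θ - Q.eta ζ) := by field_simp
    have h3 : 0 ≤ (u + K) * (θ - Q.eta ζ) := by positivity
    rw [this, hA]
    linarith
  have hpow : ∀ n, Q.eta ζ ^ n ≤ θ ^ n := fun n => pow_le_pow_left₀ hη0.le h1.le n
  have ht : ∀ n i, |Q.relCost φ n (i, true)| ≤ A * θ ^ n * ζ ^ i := by
    intro n
    induction n with
    | zero =>
      intro i
      have h4 := hb (i, true)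
      have h5 : u * ζ ^ i ≤ A * ζ ^ i :=
        mul_le_mul_of_nonneg_right (by linarith) (pow_nonneg hζ.pos.le i)
      rw [pow_zero, mul_one]
      exact h4.trans h5
    | succ n ih =>
      intro i
      have hz : 0 < ζ ^ i := pow_pos hζ.pos i
      have ht : 0 < θ ^ n := pow_pos hθ0 n
      have h4 := abs_cstep_le_eta hζ (φ i) (mul_nonneg hA0 ht.le) ih i
      have h5 : |Q.beta * Q.relCost φ n (i, false)| ≤ Q.beta * (K * θ ^ n * ζ ^ i) := by
        rw [abs_mul, abs_of_pos hβ]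
        refine mul_le_mul_of_nonneg_left ((hw' n i).trans ?_) hβ.le
        exact mul_le_mul_of_nonneg_right (mul_le_mul_of_nonneg_left (hpow n) hK) hz.le
      have h6 := mul_le_mul_of_nonneg_right hstep (mul_pos ht hz).le
      rw [relCost_succ, pstep_true]
      refine (abs_add_le _ _).trans ?_
      rw [pow_succ]
      linarith
  refine ⟨A, θ, hA0, hθ0.le, h2, fun n x => ?_⟩
  obtain ⟨i, q⟩ := x
  cases q
  · refine (hw' n i).trans (mul_le_mul_of_nonneg_right ?_ (pow_nonneg hζ.pos.le i))
    exact mul_le_mul (by linarith) (hpow n) (pow_nonneg hη0.le n) hA0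
  · exact ht n i

lemma hasSum_relCost (φ : Policy) (x : QState) :
    HasSum (fun n => Q.relCost φ n x) (Q.bias φ x) := by
  obtain ⟨K, θ, _, h0, h1, h⟩ := exists_abs_relCost_le hζ φ
  exact (Summable.of_norm_bounded
    (((summable_geometric_of_lt_one h0 h1).mul_left K).mul_right (ζ ^ x.1))
    fun n => h n x).hasSum

lemma exists_abs_bias_le (φ : Policy) : ∃ C, 0 ≤ C ∧ ∀ x, |Q.bias φ x| ≤ C * ζ ^ x.1 := by
  obtain ⟨K, θ, hK, h0, h1, h⟩ := exists_abs_relCost_le hζ φ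
  refine ⟨K * (1 - θ)⁻¹, mul_nonneg hK (inv_nonneg.2 (by linarith)), fun x => ?_⟩
  exact tsum_of_norm_bounded (f := fun n => Q.relCost φ n x)
    (((hasSum_geometric_of_lt_one h0 h1).mul_left K).mul_right (ζ ^ x.1)) fun n => h n x

/-- The Poisson equation of the policy `φ`. -/
lemma bias_eq (φ : Policy) (x : QState) :
    Q.bias φ x = Q.cost φ x - Q.gmu + Q.pstep φ (Q.bias φ) x := by
  have h := (hasSum_nat_add_iff' 1).2 (hasSum_relCost hζ φ x)
  have h2 := Q.hasSum_pstep φ (hasSum_relCost hζ φ) x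
  simp_rw [relCost_succ] at h
  have h3 := h.unique h2
  rw [Finset.sum_range_one, relCost_zero] at h3
  linarith

lemma summable_statProb_mul_relCost (φ : Policy) (q : Bool) :
    Summable fun p : ℕ × ℕ => Q.statProb p.1 * Q.relCost φ p.2 (p.1, q) := by
  obtain ⟨K, θ, hK, h0, h1, h⟩ := exists_abs_relCost_le hζ φ
  have hs := ((summable_statProb_weight hζ).mul_left K).mul_of_nonneg
    (summable_geometric_of_lt_one h0 h1)
    (fun i => mul_nonneg hK (mul_nonneg (Q.statProb_nonneg i) (pow_nonneg hζ.pos.le i)))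
    (fun n => pow_nonneg h0 n)
  refine Summable.of_norm_bounded hs fun p => ?_
  refine (norm_statProb_mul_le (C := K * θ ^ p.2) (f := fun i => Q.relCost φ p.2 (i, q))
    (fun i => h p.2 (i, q)) p.1).trans (le_of_eq ?_)
  ring

lemma hasSum_tsum_statProb_mul_relCost (φ : Policy) (q : Bool) :
    HasSum (fun n => ∑' i, Q.statProb i * Q.relCost φ n (i, q))
      (∑' i, Q.statProb i * Q.bias φ (i, q)) := by
  have hs := summable_statProb_mul_relCost hζ φ q
  have h1 : ∑' i, Q.statProb i * Q.bias φ (i, q) =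
      ∑' n, ∑' i, Q.statProb i * Q.relCost φ n (i, q) := by
    rw [Summable.tsum_comm (f := fun i n => Q.statProb i * Q.relCost φ n (i, q)) hs]
    refine tsum_congr fun i => ?_
    rw [tsum_mul_left]
    rfl
  rw [h1]
  exact hs.prod_symm.prod.hasSum

lemma tsum_statProb_mul_bias_false (φ : Policy) :
    ∑' i, Q.statProb i * Q.bias φ (i, false) = 0 := by
  have h := hasSum_tsum_statProb_mul_relCost hζ φ false
  simp_rw [tsum_statProb_mul_relCost_false hζ φ] at h
  exact h.unique hasSum_zero

end Weighted

/-! ### Laws of the chain -/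

section ChainLaw

variable (φ : Policy) (p : Measure QState) [IsProbabilityMeasure p]

instance : IsProbabilityMeasure (Q.chainLaw φ p) := by
  unfold chainLaw; infer_instance

omit [IsProbabilityMeasure p] in
lemma map_chainLaw_zero : (Q.chainLaw φ p).map (fun ω => ω 0) = p := by
  have e : (fun ω : ℕ → QState => ω 0) =
      (fun y : (_i : Finset.Iic 0) → QState => y ⟨0, Finset.mem_Iic.2 le_rfl⟩) ∘
        Preorder.frestrictLe 0 := rfl
  rw [e, ← Measure.map_map (measurable_pi_apply _) (by fun_prop), chainLaw, Kernel.trajMeasure,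
    Measure.map_comp _ _ (by fun_prop), Kernel.traj_map_frestrictLe, Kernel.partialTraj_self,
    Measure.id_comp, Measure.map_map (measurable_pi_apply _) (by fun_prop)]
  exact Measure.map_id

/-- The history kernel factors through the last coordinate, so the second marginal of the joint law
of history and next state is one step applied to the law at time `n`. -/
lemma map_chainLaw_succ (n : ℕ) :
    (Q.chainLaw φ p).map (fun ω => ω (n + 1)) =
      Q.stepKernel φ ∘ₘ (Q.chainLaw φ p).map (fun ω => ω n) := by
  have h := congrArg Measure.snd (Kernel.map_frestrictLe_trajMeasure_compProd_eq_map_trajMeasure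
    (X := fun _ => QState) (μ₀ := p) (κ := Q.historyKernel φ) (a := n))
  rw [Measure.snd_compProd, Measure.snd_map_prodMk (by fun_prop)] at h
  unfold chainLaw
  have e : Q.historyKernel φ n = Q.stepKernel φ ∘ₖ Kernel.deterministic
      (fun ω : (_i : Finset.Iic n) → QState => ω ⟨n, Finset.mem_Iic.2 le_rfl⟩)
      (measurable_pi_apply _) := (Kernel.comp_deterministic_eq_comap _ _).symm
  have h2 : (fun ω : ℕ → QState => ω n) =
      (fun y : (_i : Finset.Iic n) → QState => y ⟨n, Finset.mem_Iic.2 le_rfl⟩) ∘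
        Preorder.frestrictLe n := rfl
  rw [← h, e, ← Measure.comp_assoc, Measure.deterministic_comp_eq_map, h2,
    Measure.map_map (measurable_pi_apply _) (by fun_prop)]


/-- The moments of the chain at time `n` are those of the iterated one-step operator. -/
lemma integral_chainLaw {ζ : ℝ} (hζ : Q.Admissible ζ) (hp : Integrable (fun x : QState => ζ ^ x.1) p)
    (n : ℕ) (F : QState → ℝ) {C : ℝ} (hC : 0 ≤ C) (hF : ∀ x, |F x| ≤ C * ζ ^ x.1) :
    Integrable (fun ω => F (ω n)) (Q.chainLaw φ p) ∧
      ∫ ω, F (ω n) ∂(Q.chainLaw φ p) = ∫ x, (Q.pstep φ)^[n] F x ∂p := by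
  have hmeas : ∀ G : QState → ℝ, Measurable G := fun G => measurable_of_countable G
  suffices h : Integrable F ((Q.chainLaw φ p).map fun ω => ω n) ∧
      ∫ y, F y ∂((Q.chainLaw φ p).map fun ω => ω n) = ∫ x, (Q.pstep φ)^[n] F x ∂p by
    rw [integral_map (measurable_pi_apply n).aemeasurable (hmeas F).aestronglyMeasurable] at h
    exact ⟨h.1.comp_measurable (measurable_pi_apply n), h.2⟩
  induction n generalizing F C with
  | zero =>
    rw [map_chainLaw_zero]
    refine ⟨(hp.const_mul C).mono' (hmeas F).aestronglyMeasurable (ae_of_all _ hF), rfl⟩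
  | succ n ih =>
    rw [map_chainLaw_succ]
    have hint : Integrable F (Q.stepKernel φ ∘ₘ (Q.chainLaw φ p).map fun ω => ω n) := by
      rw [Measure.integrable_comp_iff (hmeas F).aestronglyMeasurable]
      refine ⟨ae_of_all _ fun x => Q.integrable_stepLaw φ F x, ?_⟩
      -- Integrability after one more step means integrability of the step of `|F|`, again dominated
      -- by a multiple of `ζ ^ i`; hence the induction over all `F` and `C`.
      have h := (ih (Q.pstep φ fun x => |F x|) (mul_nonneg hζ.pos.le hC)
        (abs_pstep_le hζ φ hC fun x => by rw [abs_abs]; exact hF x)).1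
      exact h.congr (ae_of_all _ fun x => (Q.integral_stepLaw φ _ x).symm)
    refine ⟨hint, ?_⟩
    rw [Measure.comp_eq_comp_const_apply] at hint ⊢
    rw [Kernel.integral_comp hint, Kernel.const_apply, Function.iterate_succ_apply,
      ← (ih (Q.pstep φ F) (mul_nonneg hζ.pos.le hC) (abs_pstep_le hζ φ hC hF)).2]
    exact integral_congr_ae (ae_of_all _ fun x => Q.integral_stepLaw φ _ x)

end ChainLaw

/-! ### The saved cost of a policy -/

instance : IsProbabilityMeasure Q.statLaw := by
  constructor
  rw [statLaw, Measure.sum_apply _ MeasurableSet.univ]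
  simp only [Measure.smul_apply, measure_univ, smul_eq_mul, mul_one]
  change ∑' i, ENNReal.ofReal (Q.statProb i) = 1
  rw [← ENNReal.ofReal_tsum_of_nonneg Q.statProb_nonneg Q.hasSum_statProb.summable,
    Q.hasSum_statProb.tsum_eq, ENNReal.ofReal_one]

instance (p : Measure ℕ) [IsProbabilityMeasure p] (q : Bool) :
    IsProbabilityMeasure (startLaw p q) :=
  Measure.isProbabilityMeasure_map (measurable_of_countable _).aemeasurable

lemma integral_statLaw {f : ℕ → ℝ} (hf : Summable fun i => Q.statProb i * |f i|) :
    Integrable f Q.statLaw ∧ ∫ i, f i ∂Q.statLaw = ∑' i, Q.statProb i * f i := by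
  have hi : Integrable f Q.statLaw := by
    rw [statLaw, integrable_sum_measure_iff]
    refine ⟨fun i => (integrable_dirac (by finiteness)).smul_measure ENNReal.ofReal_ne_top, ?_⟩
    refine hf.congr fun i => ?_
    rw [integral_smul_measure, integral_dirac, smul_eq_mul, Real.norm_eq_abs]
    congr 1
    exact (ENNReal.toReal_ofReal (Q.statProb_nonneg i)).symm
  refine ⟨hi, ?_⟩
  rw [statLaw] at hi ⊢
  rw [integral_sum_measure hi]
  refine tsum_congr fun i => ?_
  rw [integral_smul_measure, integral_dirac, smul_eq_mul]
  congr 1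
  exact ENNReal.toReal_ofReal (Q.statProb_nonneg i)

lemma integral_startLaw {F : QState → ℝ} {q : Bool}
    (hF : Summable fun i => Q.statProb i * |F (i, q)|) :
    Integrable F (startLaw Q.statLaw q) ∧
      ∫ x, F x ∂(startLaw Q.statLaw q) = ∑' i, Q.statProb i * F (i, q) := by
  have hm : AEMeasurable (fun i : ℕ => (i, q)) Q.statLaw :=
    (measurable_of_countable _).aemeasurable
  have h := Q.integral_statLaw hF
  have hF' : Measurable F := measurable_of_countable F
  rw [startLaw, integrable_map_measure hF'.aestronglyMeasurable hm,
    integral_map hm hF'.aestronglyMeasurable]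
  exact h

/-- The total saved cost of the policy `φ` in the stationary regime. -/
def savedCost (φ : Policy) : ℝ := - ∑' i, Q.statProb i * Q.bias φ (i, true)

section Weighted

variable {Q} {ζ : ℝ} (hζ : Q.Admissible ζ)
include hζ

lemma integral_cost_chainLaw (φ : Policy) (n : ℕ) (q : Bool) :
    Integrable (fun ω => Q.cost φ (ω n) - Q.gmu) (Q.chainLaw φ (startLaw Q.statLaw q)) ∧
      ∫ ω, (Q.cost φ (ω n) - Q.gmu) ∂(Q.chainLaw φ (startLaw Q.statLaw q)) =
        ∑' i, Q.statProb i * Q.relCost φ n (i, q) := by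
  obtain ⟨u, hu⟩ := exists_isCostBound hζ
  obtain ⟨K, θ, _, _, _, hK⟩ := exists_abs_relCost_le hζ φ
  have hp : Integrable (fun x : QState => ζ ^ x.1) (startLaw Q.statLaw q) := by
    refine (Q.integral_startLaw ?_).1
    simp_rw [abs_pow, abs_of_pos hζ.pos]
    exact summable_statProb_weight hζ
  have h := Q.integral_chainLaw φ _ hζ hp n (fun x => Q.cost φ x - Q.gmu) hu.pos.le fun x =>
    (hu.abs_cost_sub_le φ x).trans (mul_le_mul_of_nonneg_left (weight_le_pow hζ x) hu.pos.le)
  refine ⟨h.1, h.2.trans (Q.integral_startLaw (F := Q.relCost φ n) ?_).2⟩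
  exact summable_statProb_mul hζ fun i => by rw [abs_abs]; exact hK n (i, q)

/-- Subtracting `g_μ` from both costs makes every expectation for the stationary chain `X` vanish,
so only `Y` contributes. -/
lemma isSavedCost_statLaw (φ : Policy) : Q.IsSavedCost φ Q.statLaw (Q.savedCost φ) := by
  have hX := fun n => integral_cost_chainLaw hζ φ n false
  have hY := fun n => integral_cost_chainLaw hζ φ n true
  have hX' : ∀ n, Integrable (fun ω : (ℕ → QState) × (ℕ → QState) => Q.cost φ (ω.1 n) - Q.gmu)
      (Q.pairLaw φ Q.statLaw) := fun n => (hX n).1.comp_fst _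
  have hY' : ∀ n, Integrable (fun ω : (ℕ → QState) × (ℕ → QState) => Q.cost φ (ω.2 n) - Q.gmu)
      (Q.pairLaw φ Q.statLaw) := fun n => (hY n).1.comp_snd _
  have e : ∀ n, (fun ω : (ℕ → QState) × (ℕ → QState) => Q.cost φ (ω.1 n) - Q.cost φ (ω.2 n)) =
      fun ω => (Q.cost φ (ω.1 n) - Q.gmu) - (Q.cost φ (ω.2 n) - Q.gmu) := fun n => by
    ext ω; ring
  refine ⟨fun n => by rw [e]; exact (hX' n).sub (hY' n), ?_⟩
  refine (hasSum_tsum_statProb_mul_relCost hζ φ true).neg.congr_fun fun n => ?_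
  rw [e, integral_sub (hX' n) (hY' n)]
  have h1 : ∫ ω, (Q.cost φ (ω.1 n) - Q.gmu) ∂(Q.pairLaw φ Q.statLaw) = 0 := by
    rw [pairLaw, integral_fun_fst (fun ω : ℕ → QState => Q.cost φ (ω n) - Q.gmu), (hX n).2,
      tsum_statProb_mul_relCost_false hζ, smul_zero]
  have h2 : ∫ ω, (Q.cost φ (ω.2 n) - Q.gmu) ∂(Q.pairLaw φ Q.statLaw) =
      ∑' i, Q.statProb i * Q.relCost φ n (i, true) := by
    rw [pairLaw, integral_fun_snd (fun ω : ℕ → QState => Q.cost φ (ω n) - Q.gmu), (hY n).2]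
    simp
  rw [h1, h2, zero_sub]

end Weighted

/-! ### The relative value of the uncontrolled queue -/

/-- The relative value of the uncontrolled states, normalised at the empty state. -/
def freeRel (i : ℕ) : ℝ :=
  Q.bias (fun _ => Rate.slow) (i, false) - Q.bias (fun _ => Rate.slow) (0, false)

lemma freeRel_zero : Q.freeRel 0 = 0 := sub_self _

lemma mul_auxStep (V : ℕ → ℝ) (a : Rate) (i : ℕ) :
    (1 - Q.beta) * Q.auxStep V a i = Q.cstep a V i := by
  have : 1 - Q.beta ≠ 0 := by linarith [Q.beta_lt_one]
  unfold auxStep cstep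
  field_simp
  ring

lemma auxVI_succ (H : QState → ℝ) (n i : ℕ) :
    Q.auxVI H (n + 1) i =
      min (Q.auxCost H Rate.slow i + Q.cstep Rate.slow (Q.auxVI H n) i)
        (Q.auxCost H Rate.fast i + Q.cstep Rate.fast (Q.auxVI H n) i) := by
  rw [← mul_auxStep, ← mul_auxStep]
  rfl

/-- Value iteration sees `H` only on uncontrolled states, so it can be run with `freeRel` before the
controlled part of the solution exists. -/
lemma auxVI_congr {H H' : QState → ℝ} (h : ∀ i, H (i, false) = H' (i, false)) (n : ℕ) :
    Q.auxVI H n = Q.auxVI H' n := by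
  induction n with
  | zero => rfl
  | succ n ih =>
    ext i
    rw [auxVI_succ, auxVI_succ, ih]
    simp only [auxCost, h]

/-- The limit of value iteration in the auxiliary discounted model. -/
def optRel (i : ℕ) : ℝ :=
  Filter.limUnder Filter.atTop fun n => Q.auxVI (fun x => Q.freeRel x.1) n i

/-- The normalised solution of the average cost optimality equation. -/
def relValue : QState → ℝ
  | (i, true) => Q.optRel i
  | (i, false) => Q.freeRel i

section Weighted

variable {Q} {ζ : ℝ} (hζ : Q.Admissible ζ)
include hζ

lemma freeRel_eq (i : ℕ) : Q.freeRel i = Q.cmu + Q.h i - Q.gmu + Q.fstep Q.freeRel i := by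
  have h := bias_eq hζ (fun _ => Rate.slow) (i, false)
  rw [pstep_false, cost] at h
  have e : Q.fstep Q.freeRel i = Q.fstep (fun j => Q.bias (fun _ => Rate.slow) (j, false)) i -
      Q.bias (fun _ => Rate.slow) (0, false) := by
    simp only [fstep, freeRel]; ring
  rw [e, freeRel]
  linarith

lemma exists_abs_freeRel_le : ∃ C, 0 ≤ C ∧ ∀ i, |Q.freeRel i| ≤ C * ζ ^ i := by
  obtain ⟨C, hC, h⟩ := exists_abs_bias_le hζ (fun _ => Rate.slow)
  refine ⟨2 * C, by linarith, fun i => (abs_sub _ _).trans ?_⟩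
  have h1 := h (i, false)
  have h2 := h (0, false)
  have h3 := le_mul_of_one_le_right hC (one_le_pow₀ hζ.one_lt.le (n := i))
  simp only [pow_zero, mul_one] at h1 h2
  linarith

/-- The non-explicit bound of `exists_abs_freeRel_le` is needed to start the contraction, which then
replaces it by the sharp constant. -/
lemma abs_freeRel_le {u : ℝ} (hu : Q.IsCostBound ζ u) (i : ℕ) :
    |Q.freeRel i| ≤ u / (1 - Q.eta ζ) * (ζ ^ i / 2) := by
  obtain ⟨C, hC, h⟩ := exists_abs_freeRel_le hζ
  refine abs_le_of_contraction (M := fun i => ζ ^ i / 2) (C := 2 * C)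
    (fun i => weight_nonneg hζ.pos.le (i, false)) hζ.eta_pos.le hζ.eta_lt_one hu.pos.le
    (by linarith) (fun i => by linarith [h i]) (fun B hB hb i => ?_) i
  have h1 := hu.abs_cost_sub_le (fun _ => Rate.slow) (i, false)
  have h2 := abs_fstep_le_eta hζ (C := B / 2) (by linarith) Q.freeRel_zero
    (fun i => by linarith [hb i]) i
  rw [freeRel_eq hζ]
  refine (abs_add_le _ _).trans ?_
  simp only [cost, weight] at h1
  linarith

/-! ### Value iteration in the auxiliary model -/

lemma Ktilde_pos {u : ℝ} (hu : Q.IsCostBound ζ u) : 0 < Q.Ktilde ζ u := by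
  have h1 := hu.pos
  have h2 := Q.gmu_nonneg
  have h3 : 0 < 1 - Q.eta ζ := by linarith [hζ.eta_lt_one]
  have h4 := Q.beta_pos
  have : 0 < Q.beta * u / (1 - Q.eta ζ) := by positivity
  unfold Ktilde
  linarith

/-- In `K̃`, the term `u` pays for the cost minus `g_μ` and `β u / (1 - η)` for `β H*(i,0)`; the
summand `g_μ` is slack. -/
lemma abs_auxCost_le {u : ℝ} (hu : Q.IsCostBound ζ u) (a : Rate) (i : ℕ) :
    |Q.auxCost (fun x => Q.freeRel x.1) a i| ≤ Q.Ktilde ζ u * ζ ^ i := by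
  have h1 := hu.abs_cost_sub_le (fun _ => a) (i, true)
  have h2 := abs_freeRel_le hζ hu i
  have hz := pow_pos hζ.pos i
  have h3 : 0 < 1 - Q.eta ζ := by linarith [hζ.eta_lt_one]
  have hu0 := hu.pos
  have hβ := Q.beta_pos
  have h4 := mul_le_mul_of_nonneg_left h2 hβ.le
  have h5 : 0 ≤ Q.beta * (u / (1 - Q.eta ζ) * ζ ^ i) := by positivity
  have h6 := mul_nonneg Q.gmu_nonneg hz.le
  have h7 : Q.Ktilde ζ u * ζ ^ i =
      Q.gmu * ζ ^ i + u * ζ ^ i + Q.beta * (u / (1 - Q.eta ζ) * ζ ^ i) := by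
    unfold Ktilde; ring
  simp only [cost, weight] at h1
  unfold auxCost
  refine (abs_add_le _ _).trans ?_
  rw [abs_mul, abs_of_pos hβ, h7]
  linarith

lemma abs_auxVI_succ_sub_le {u : ℝ} (hu : Q.IsCostBound ζ u) (n i : ℕ) :
    |Q.auxVI (fun x => Q.freeRel x.1) (n + 1) i - Q.auxVI (fun x => Q.freeRel x.1) n i| ≤
      Q.Ktilde ζ u * ((1 - Q.beta) * ζ) ^ n * ζ ^ i := by
  induction n generalizing i with
  | zero =>
    have e : ∀ a, Q.cstep a (Q.auxVI (fun x => Q.freeRel x.1) 0) i = 0 := fun a => by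
      simp [cstep, auxVI]
    have e0 : Q.auxVI (fun x => Q.freeRel x.1) 0 i = 0 := rfl
    rw [auxVI_succ, e, e, e0, add_zero, add_zero, sub_zero, pow_zero, mul_one]
    exact (abs_min_le_max_abs_abs).trans
      (max_le (abs_auxCost_le hζ hu _ i) (abs_auxCost_le hζ hu _ i))
  | succ n ih =>
    have hs : ∀ a, |Q.auxCost (fun x => Q.freeRel x.1) a i +
        Q.cstep a (Q.auxVI (fun x => Q.freeRel x.1) (n + 1)) i -
        (Q.auxCost (fun x => Q.freeRel x.1) a i +
          Q.cstep a (Q.auxVI (fun x => Q.freeRel x.1) n) i)| ≤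
        Q.Ktilde ζ u * ((1 - Q.beta) * ζ) ^ (n + 1) * ζ ^ i := by
      intro a
      rw [add_sub_add_left_eq_sub, ← cstep_sub]
      refine (abs_cstep_le_discount hζ a (mul_nonneg (Ktilde_pos hζ hu).le
        (pow_nonneg hζ.discount_pos.le n)) ih i).trans (le_of_eq ?_)
      ring
    rw [auxVI_succ, auxVI_succ _ _ n]
    exact (abs_min_sub_min_le_max _ _ _ _).trans (max_le (hs _) (hs _))

lemma dist_auxVI_succ_le {u : ℝ} (hu : Q.IsCostBound ζ u) (i n : ℕ) :
    dist (Q.auxVI (fun x => Q.freeRel x.1) n i) (Q.auxVI (fun x => Q.freeRel x.1) (n + 1) i) ≤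
      Q.Ktilde ζ u * ζ ^ i * ((1 - Q.beta) * ζ) ^ n := by
  rw [dist_comm, Real.dist_eq]
  exact (abs_auxVI_succ_sub_le hζ hu n i).trans (le_of_eq (by ring))

lemma tendsto_auxVI (i : ℕ) : Filter.Tendsto (fun n => Q.auxVI (fun x => Q.freeRel x.1) n i)
    Filter.atTop (nhds (Q.optRel i)) := by
  obtain ⟨u, hu⟩ := exists_isCostBound hζ
  exact (cauchySeq_of_le_geometric _ _ hζ.discount_lt_one
    (dist_auxVI_succ_le hζ hu i)).tendsto_limUnder

lemma abs_auxVI_sub_optRel_le {u : ℝ} (hu : Q.IsCostBound ζ u) (n i : ℕ) :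
    |Q.auxVI (fun x => Q.freeRel x.1) n i - Q.optRel i| ≤
      Q.Ktilde ζ u * ζ ^ i * ((1 - Q.beta) * ζ) ^ n / (1 - (1 - Q.beta) * ζ) :=
  dist_le_of_le_geometric_of_tendsto _ _ hζ.discount_lt_one (dist_auxVI_succ_le hζ hu i)
    (tendsto_auxVI hζ i) n

lemma optRel_eq (i : ℕ) : Q.optRel i =
    min (Q.auxCost (fun x => Q.freeRel x.1) Rate.slow i + Q.cstep Rate.slow Q.optRel i)
      (Q.auxCost (fun x => Q.freeRel x.1) Rate.fast i + Q.cstep Rate.fast Q.optRel i) := by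
  have h1 := (Filter.tendsto_add_atTop_iff_nat 1).2 (tendsto_auxVI hζ i)
  have hc : ∀ a, Filter.Tendsto (fun n => Q.auxCost (fun x => Q.freeRel x.1) a i +
      Q.cstep a (Q.auxVI (fun x => Q.freeRel x.1) n) i) Filter.atTop
      (nhds (Q.auxCost (fun x => Q.freeRel x.1) a i + Q.cstep a Q.optRel i)) := fun a =>
    (((((tendsto_auxVI hζ _).const_mul _).add ((tendsto_auxVI hζ _).const_mul _)).add
      ((tendsto_auxVI hζ _).const_mul _))).const_add _
  refine tendsto_nhds_unique h1 (((hc Rate.slow).min (hc Rate.fast)).congr fun n => ?_)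
  rw [auxVI_succ]

/-! ### The optimality equation -/

/-- Contraction of the controlled queue when the state `(0, 0)` is taboo. -/
lemma abs_pstep_le_eta (φ : Policy) {F : QState → ℝ} {C : ℝ} (hC : 0 ≤ C)
    (h0 : F (0, false) = 0) (hF : ∀ x, |F x| ≤ C * weight ζ x) (x : QState) :
    |Q.pstep φ F x| ≤ Q.eta ζ * C * weight ζ x := by
  have hβ := Q.beta_pos
  obtain ⟨i, q⟩ := x
  cases q
  · have h := abs_fstep_le_eta hζ (C := C / 2) (by linarith) h0
      (fun j => (hF (j, false)).trans (le_of_eq (by rw [weight]; ring))) i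
    refine h.trans (le_of_eq ?_)
    rw [weight]; ring
  · have h1 := Q.abs_cstep_le_cstep (φ i) (fun j => hF (j, true)) i
    rw [pstep_true]
    refine (abs_add_le _ _).trans ?_
    simp only [weight] at h1 ⊢
    have hz := pow_pos hζ.pos i
    have hCz := mul_nonneg hC hz.le
    cases i with
    | zero =>
      rw [cstep_weight_zero] at h1
      have := mul_le_mul_of_nonneg_right (Q.le_eta_control (ζ := ζ)) hCz
      -- From `(0, 1)` loss of control leads into the taboo state, so the full `β` is gained.
      rw [h0, mul_zero, abs_zero]
      linarith
    | succ i =>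
      rw [cstep_weight_succ hζ] at h1
      have h2 : |Q.beta * F (i + 1, false)| ≤ Q.beta * (C * (ζ ^ (i + 1) / 2)) := by
        rw [abs_mul, abs_of_pos hβ]
        exact mul_le_mul_of_nonneg_left (hF (i + 1, false)) hβ.le
      have h3 := mul_le_mul_of_nonneg_left (Q.mu1_le_rate (φ (i + 1))) hζ.one_sub_inv_pos.le
      -- Elsewhere loss of control halves the weight, and only `β / 2` is gained.
      have h4 : 1 - Q.lam + Q.lam * ζ - Q.beta - (1 - 1 / ζ) * Q.rate (φ (i + 1)) + Q.beta / 2 ≤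
          Q.eta ζ := by
        linarith [Q.le_eta_slow (ζ := ζ)]
      have := mul_le_mul_of_nonneg_right h4 hCz
      linarith

lemma gmu_add_relValue_le (φ : Policy) (x : QState) :
    Q.gmu + Q.relValue x ≤ Q.cost φ x + Q.pstep φ Q.relValue x := by
  obtain ⟨i, q⟩ := x
  cases q
  · have h := freeRel_eq hζ i
    simp only [relValue, cost, pstep_false]
    linarith
  · have h := optRel_eq hζ i
    have hle : Q.optRel i ≤
        Q.auxCost (fun x => Q.freeRel x.1) (φ i) i + Q.cstep (φ i) Q.optRel i := by
      rw [h]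
      cases φ i
      · exact min_le_left _ _
      · exact min_le_right _ _
    simp only [relValue, cost, pstep_true, auxCost] at hle ⊢
    linarith

lemma exists_optimal_policy :
    ∃ φ : Policy, ∀ x, Q.gmu + Q.relValue x = Q.cost φ x + Q.pstep φ Q.relValue x := by
  have h : ∀ i, ∃ a, Q.optRel i =
      Q.auxCost (fun x => Q.freeRel x.1) a i + Q.cstep a Q.optRel i := by
    intro i
    rcases min_choice (Q.auxCost (fun x => Q.freeRel x.1) Rate.slow i +
        Q.cstep Rate.slow Q.optRel i)
      (Q.auxCost (fun x => Q.freeRel x.1) Rate.fast i + Q.cstep Rate.fast Q.optRel i) with h | h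
    · exact ⟨_, (optRel_eq hζ i).trans h⟩
    · exact ⟨_, (optRel_eq hζ i).trans h⟩
  choose φ hφ using h
  refine ⟨φ, fun x => ?_⟩
  obtain ⟨i, q⟩ := x
  cases q
  · have h := freeRel_eq hζ i
    simp only [relValue, cost, pstep_false]
    linarith
  · have h := hφ i
    simp only [relValue, cost, pstep_true, auxCost] at h ⊢
    linarith

lemma exists_abs_relValue_le : ∃ C, 0 ≤ C ∧ ∀ x, |Q.relValue x| ≤ C * weight ζ x := by
  obtain ⟨u, hu⟩ := exists_isCostBound hζ
  obtain ⟨C, hC, h⟩ := exists_abs_freeRel_le hζ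
  have hK := Ktilde_pos hζ hu
  have hγ : 0 < 1 - (1 - Q.beta) * ζ := by linarith [hζ.discount_lt_one]
  have hB : 0 ≤ Q.Ktilde ζ u / (1 - (1 - Q.beta) * ζ) := by positivity
  refine ⟨Q.Ktilde ζ u / (1 - (1 - Q.beta) * ζ) + 2 * C, by linarith, fun x => ?_⟩
  obtain ⟨i, q⟩ := x
  have hz := pow_pos hζ.pos i
  have h3 := mul_nonneg hB hz.le
  have h4 := mul_nonneg hC hz.le
  cases q
  · have h1 := h i
    simp only [relValue, weight]
    linarith
  · have h1 := abs_auxVI_sub_optRel_le hζ hu 0 i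
    have e0 : Q.auxVI (fun x => Q.freeRel x.1) 0 i = 0 := rfl
    rw [e0, zero_sub, abs_neg, pow_zero, mul_one, mul_div_right_comm] at h1
    simp only [relValue, weight]
    linarith

lemma abs_relValue_le {u : ℝ} (hu : Q.IsCostBound ζ u) (x : QState) :
    |Q.relValue x| ≤ u / (1 - Q.eta ζ) * weight ζ x := by
  obtain ⟨C, hC, h⟩ := exists_abs_relValue_le hζ
  obtain ⟨φ, hφ⟩ := exists_optimal_policy hζ
  refine abs_le_of_contraction (weight_nonneg hζ.pos.le) hζ.eta_pos.le hζ.eta_lt_one hu.pos.le hC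
    h (fun B hB hb x => ?_) x
  -- A minimising policy makes the equation linear, so the contraction applies directly.
  have e : Q.relValue x = (Q.cost φ x - Q.gmu) + Q.pstep φ Q.relValue x := by linarith [hφ x]
  have h1 := hu.abs_cost_sub_le φ x
  have h2 := abs_pstep_le_eta hζ φ hB Q.freeRel_zero hb x
  rw [e]
  refine (abs_add_le _ _).trans ?_
  linarith

omit hζ in
lemma isRelativeValue_iff {g : ℝ} {H : QState → ℝ} :
    Q.IsRelativeValue ζ g H ↔ (∃ C : ℝ, ∀ x, |H x| ≤ C * weight ζ x) ∧ H (0, false) = 0 ∧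
      ∀ x, (∃ φ, Q.cost φ x + Q.pstep φ H x = g + H x) ∧
        ∀ φ, g + H x ≤ Q.cost φ x + Q.pstep φ H x := by
  have e : ∀ φ x, ∫ y, H y ∂(Q.stepKernel φ x) = Q.pstep φ H x := fun φ x =>
    Q.integral_stepLaw φ H x
  simp only [IsRelativeValue, IsLeast, e, mem_lowerBounds, Set.mem_range, forall_exists_index,
    forall_apply_eq_imp_iff]

lemma isRelativeValue_relValue : Q.IsRelativeValue ζ Q.gmu Q.relValue := by
  obtain ⟨C, _, hC⟩ := exists_abs_relValue_le hζ
  obtain ⟨φ, hφ⟩ := exists_optimal_policy hζ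
  exact isRelativeValue_iff.2 ⟨⟨C, hC⟩, Q.freeRel_zero, fun x =>
    ⟨⟨φ, (hφ x).symm⟩, fun ψ => gmu_add_relValue_le hζ ψ x⟩⟩

lemma IsRelativeValue.unique {g : ℝ} {H : QState → ℝ} (hH : Q.IsRelativeValue ζ g H) :
    g = Q.gmu ∧ H = Q.relValue := by
  obtain ⟨⟨C, hC⟩, h0, hopt⟩ := isRelativeValue_iff.1 hH
  have hC0 : 0 ≤ C := by
    have := (abs_nonneg _).trans (hC (0, true))
    simpa [weight] using this
  -- On uncontrolled states the equation has no minimum; averaging it against the invariant law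
  -- cancels `H`.
  have hg : g = Q.gmu := by
    obtain ⟨D, hD, hh⟩ := exists_h_le hζ
    have hf : ∀ i, |H (i, false)| ≤ C * ζ ^ i := fun i =>
      (hC _).trans (mul_le_mul_of_nonneg_left (weight_le_pow hζ (i, false)) hC0)
    have e : ∀ i, g + H (i, false) = (Q.cmu + Q.h i) + Q.fstep (fun j => H (j, false)) i := by
      intro i
      obtain ⟨φ, hφ⟩ := (hopt (i, false)).1
      exact hφ.symm
    have hs1 := summable_statProb_mul hζ hf
    have hs2 := summable_statProb_mul hζ (abs_fstep_le hζ hC0 hf)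
    have hs3 : Summable fun i => Q.statProb i * (Q.cmu + Q.h i) := by
      have := (Q.hasSum_statProb.summable.mul_right Q.cmu).add (summable_statProb_mul hζ
        (f := Q.h) (C := D) fun i => by rw [abs_of_nonneg (Q.h_nonneg i)]; exact hh i)
      exact this.congr fun i => by ring
    have h1 := (Q.hasSum_statProb.mul_right g).add hs1.hasSum
    have h2 := hs3.hasSum.add hs2.hasSum
    rw [tsum_statProb_mul_cost hζ, tsum_statProb_mul_fstep hζ hC0 hf] at h2
    have h3 := h1.unique (h2.congr_fun fun i => by rw [← mul_add, ← mul_add, e])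
    linarith
  refine ⟨hg, ?_⟩
  subst hg
  obtain ⟨D, hD, hR⟩ := exists_abs_relValue_le hζ
  obtain ⟨φ, hφ⟩ := exists_optimal_policy hζ
  ext x
  have key := abs_le_of_contraction (F := fun x => H x - Q.relValue x) (M := weight ζ) (u := 0)
    (C := C + D) (weight_nonneg hζ.pos.le) hζ.eta_pos.le hζ.eta_lt_one le_rfl
    (add_nonneg hC0 hD)
    (fun x => (abs_sub _ _).trans (by linarith [hC x, hR x])) (fun B hB hb x => ?_) x
  · rw [zero_div, zero_mul] at key
    exact sub_eq_zero.1 (abs_nonpos_iff.1 key)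
  · have hz : H (0, false) - Q.relValue (0, false) = 0 := by
      rw [h0, zero_sub, neg_eq_zero]; exact Q.freeRel_zero
    have hs := fun ψ => abs_pstep_le_eta hζ ψ hB hz hb x
    -- The minimiser `φ` for `relValue` bounds the difference from above, the minimiser `ψ` for `H`
    -- at `x` from below.
    obtain ⟨ψ, hψ⟩ := (hopt x).1
    have h1 := abs_le.1 (hs φ)
    have h2 := abs_le.1 (hs ψ)
    rw [pstep_sub] at h1 h2
    have h3 := (hopt x).2 φ
    have h4 := gmu_add_relValue_le hζ ψ x
    rw [zero_add]
    exact abs_le.2 ⟨by linarith [hφ x], by linarith [hφ x]⟩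

/-! ### The optimal saved cost -/

omit hζ in
lemma bias_sub_relValue_false (φ : Policy) (i : ℕ) :
    Q.bias φ (i, false) - Q.bias φ (0, false) - Q.relValue (i, false) = 0 := by
  rw [relValue, freeRel, bias_false Q φ (fun _ => Rate.slow), bias_false Q φ (fun _ => Rate.slow)]
  ring

lemma exists_abs_bias_sub_relValue_le (φ : Policy) : ∃ C, 0 ≤ C ∧
    ∀ x, |Q.bias φ x - Q.bias φ (0, false) - Q.relValue x| ≤ C * weight ζ x := by
  obtain ⟨C, hC, h⟩ := exists_abs_bias_le hζ φ
  obtain ⟨D, hD, hR⟩ := exists_abs_relValue_le hζ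
  refine ⟨4 * C + D, by linarith, fun x => ?_⟩
  refine (abs_sub _ _).trans ((add_le_add_left (abs_sub _ _) _).trans ?_)
  have h1 := mul_le_mul_of_nonneg_left (half_pow_le_weight hζ x) hC
  have h2 := h (0, false)
  have h3 := le_mul_of_one_le_right hC (one_le_pow₀ hζ.one_lt.le (n := x.1))
  simp only [pow_zero, mul_one] at h2
  linarith [h x, hR x]

/-- The difference `F` vanishes without control and is a supersolution for the killed controlled
chain. Its negative part is therefore dominated by its own image under a contraction, hence zero. -/
lemma relValue_le_bias (φ : Policy) (i : ℕ) :
    Q.relValue (i, true) ≤ Q.bias φ (i, true) - Q.bias φ (0, false) := by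
  obtain ⟨C, hC, hb⟩ := exists_abs_bias_sub_relValue_le hζ φ
  set F : QState → ℝ := fun x => Q.bias φ x - Q.bias φ (0, false) - Q.relValue x with hF
  have hsuper : ∀ i, Q.cstep (φ i) (fun j => F (j, true)) i ≤ F (i, true) := by
    intro i
    have h1 := bias_eq hζ φ (i, true)
    have h2 := gmu_add_relValue_le hζ φ (i, true)
    have h3 : Q.pstep φ F (i, true) = Q.pstep φ (Q.bias φ) (i, true) - Q.bias φ (0, false) -
        Q.pstep φ Q.relValue (i, true) := by
      rw [hF, pstep_sub, pstep_sub, pstep_const]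
    have h4 : F (i, false) = 0 := bias_sub_relValue_false φ i
    rw [pstep_true, h4, mul_zero, add_zero] at h3
    rw [h3, hF]
    simp only
    linarith
  have key := abs_le_of_contraction (F := fun i => max (-F (i, true)) 0) (M := fun i => ζ ^ i)
    (u := 0) (C := C) (fun i => pow_nonneg hζ.pos.le i) hζ.eta_pos.le hζ.eta_lt_one le_rfl hC
    (fun i => ?_) (fun B hB hN i => ?_) i
  · rw [zero_div, zero_mul] at key
    have h1 := (le_abs_self _).trans key
    have h2 := (le_max_left (-F (i, true)) 0).trans h1
    rw [hF] at h2
    simp only at h2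
    linarith
  · rw [abs_of_nonneg (le_max_right _ _)]
    exact max_le ((neg_le_abs _).trans (hb (i, true)))
      (mul_nonneg hC (pow_nonneg hζ.pos.le i))
  · have h1 := (le_abs_self _).trans (abs_cstep_le_eta hζ (φ i) hB hN i)
    have h2 := Q.cstep_mono (φ i) (f := fun j => -F (j, true)) (fun j => le_max_left _ 0) i
    have h3 : Q.cstep (φ i) (fun j => -F (j, true)) i = - Q.cstep (φ i) (fun j => F (j, true)) i := by
      unfold cstep; ring
    rw [abs_of_nonneg (le_max_right _ _), zero_add]
    refine max_le ?_ (mul_nonneg (mul_nonneg hζ.eta_pos.le hB) (pow_nonneg hζ.pos.le i))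
    linarith [hsuper i]

/-- Both sides solve the Poisson equation of `φ`; their difference is invariant under the step and
vanishes at `(0, 0)`. -/
lemma bias_eq_relValue {φ : Policy}
    (hφ : ∀ x, Q.gmu + Q.relValue x = Q.cost φ x + Q.pstep φ Q.relValue x) (x : QState) :
    Q.bias φ x - Q.bias φ (0, false) = Q.relValue x := by
  obtain ⟨C, hC, hb⟩ := exists_abs_bias_sub_relValue_le hζ φ
  have key := abs_le_of_contraction
    (F := fun x => Q.bias φ x - Q.bias φ (0, false) - Q.relValue x) (u := 0)
    (weight_nonneg hζ.pos.le) hζ.eta_pos.le hζ.eta_lt_one le_rfl hC hb (fun B hB hB' x => ?_) x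
  · rw [zero_div, zero_mul] at key
    exact sub_eq_zero.1 (abs_nonpos_iff.1 key)
  · have h1 := abs_pstep_le_eta hζ φ hB (bias_sub_relValue_false φ 0) hB' x
    rw [pstep_sub, pstep_sub, pstep_const] at h1
    have e : Q.bias φ x - Q.bias φ (0, false) - Q.relValue x =
        Q.pstep φ (Q.bias φ) x - Q.bias φ (0, false) - Q.pstep φ Q.relValue x := by
      linarith [bias_eq hζ φ x, hφ x]
    rw [e, zero_add]
    exact h1

lemma summable_statProb_mul_bias (φ : Policy) (q : Bool) :
    Summable fun i => Q.statProb i * Q.bias φ (i, q) := by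
  obtain ⟨C, _, h⟩ := exists_abs_bias_le hζ φ
  exact summable_statProb_mul hζ fun i => h (i, q)

/-- The comparison of biases is pointwise in `i`, so one minimising policy attains the supremum. The
normalising constant cancels in the difference, and the uncontrolled bias has stationary mean zero.
-/
lemma isOptimalSavedCost_statLaw : Q.IsOptimalSavedCost Q.statLaw
    (∑' i, Q.statProb i * (Q.relValue (i, false) - Q.relValue (i, true))) := by
  obtain ⟨φ, hφ⟩ := exists_optimal_policy hζ
  have e : ∑' i, Q.statProb i * (Q.relValue (i, false) - Q.relValue (i, true)) =
      Q.savedCost φ := by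
    have h := (summable_statProb_mul_bias hζ φ false).hasSum.sub
      (summable_statProb_mul_bias hζ φ true).hasSum
    rw [tsum_statProb_mul_bias_false hζ, zero_sub] at h
    rw [savedCost, ← h.tsum_eq]
    refine tsum_congr fun i => ?_
    rw [← bias_eq_relValue hζ hφ, ← bias_eq_relValue hζ hφ]
    ring
  rw [e]
  refine ⟨Q.savedCost, isSavedCost_statLaw hζ, IsGreatest.isLUB ⟨⟨φ, rfl⟩, ?_⟩⟩
  rintro _ ⟨ψ, rfl⟩
  refine neg_le_neg ((summable_statProb_mul_bias hζ φ true).tsum_le_tsum (fun i => ?_)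
    (summable_statProb_mul_bias hζ ψ true))
  refine mul_le_mul_of_nonneg_left ?_ (Q.statProb_nonneg i)
  have h1 := relValue_le_bias hζ ψ i
  rw [← bias_eq_relValue hζ hφ, bias_false Q ψ φ] at h1
  linarith

/-! ### The approximation -/

lemma abs_Htilde_sub_relValue_le {u ε : ℝ} (hu : Q.IsCostBound ζ u) (hε : 0 < ε) {k i : ℕ}
    (hik : i ≤ k) : |Q.Htilde ζ u Q.relValue ε k i - Q.relValue (i, true)| ≤ ε := by
  have hK := Ktilde_pos hζ hu
  have hγ : 0 < 1 - (1 - Q.beta) * ζ := by linarith [hζ.discount_lt_one]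
  have hz : 0 < ζ ^ k := pow_pos hζ.pos k
  have hX : 0 < ε * (1 - (1 - Q.beta) * ζ) / (Q.Ktilde ζ u * ζ ^ k) := by positivity
  have h1 := abs_auxVI_sub_optRel_le hζ hu (Q.ntilde ζ u ε k) i
  have h2 : ((1 - Q.beta) * ζ) ^ Q.ntilde ζ u ε k ≤
      ε * (1 - (1 - Q.beta) * ζ) / (Q.Ktilde ζ u * ζ ^ k) := by
    -- The base is below one, so exponents above the logarithm give smaller powers; the cut of
    -- `⌈·⌉₊` at `0` only raises the exponent.
    rw [← Real.rpow_natCast]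
    exact (Real.logb_le_iff_le_rpow_of_base_lt_one hζ.discount_pos hζ.discount_lt_one hX).1
      (Nat.le_ceil _)
  rw [Htilde, Q.auxVI_congr (H' := fun x => Q.freeRel x.1) (fun _ => rfl), relValue]
  refine h1.trans ((div_le_iff₀ hγ).2 ?_)
  have h3 : Q.Ktilde ζ u * ζ ^ i ≤ Q.Ktilde ζ u * ζ ^ k :=
    mul_le_mul_of_nonneg_left (pow_le_pow_right₀ hζ.one_lt.le hik) hK.le
  refine (mul_le_mul h3 h2 (pow_nonneg hζ.discount_pos.le _) (by positivity)).trans (le_of_eq ?_)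
  field_simp

lemma abs_tsum_sub_approxSavedCost_le {u ε : ℝ} (hu : Q.IsCostBound ζ u) (hε : 0 < ε) :
    |∑' i, Q.statProb i * (Q.relValue (i, false) - Q.relValue (i, true)) -
      Q.approxSavedCost ζ u Q.relValue ε| ≤ ε := by
  set N := (Q.ktilde ζ u ε + 1).toNat with hN
  have hη : 0 < 1 - Q.eta ζ := by linarith [hζ.eta_lt_one]
  have hr : 0 < 1 - Q.rho * ζ := by linarith [hζ.rho_mul_lt_one]
  have hρ : 0 < 1 - Q.rho := by linarith [Q.rho_lt_one]
  have hu0 := hu.pos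
  -- The weights add up to `3/2`, rounded up to `2`; allotting `ε / 2` to the tail then gives the
  -- `4` in `k̃_ε`.
  set B := 2 * (u / (1 - Q.eta ζ)) with hB
  have hB0 : 0 < B := by positivity
  have hd : ∀ i, |Q.relValue (i, false) - Q.relValue (i, true)| ≤ B * ζ ^ i := by
    intro i
    refine (abs_sub _ _).trans ?_
    have h1 := abs_relValue_le hζ hu (i, false)
    have h2 := abs_relValue_le hζ hu (i, true)
    have h3 : 0 ≤ u / (1 - Q.eta ζ) * ζ ^ i :=
      mul_nonneg (by positivity) (pow_nonneg hζ.pos.le i)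
    simp only [weight] at h1 h2
    rw [hB]
    linarith
  have hs := summable_statProb_mul hζ hd
  have htail : |∑' i, Q.statProb (i + N) *
      (Q.relValue (i + N, false) - Q.relValue (i + N, true))| ≤ ε / 2 := by
    have hgeo := ((hasSum_geometric_of_lt_one hζ.rho_mul_pos.le hζ.rho_mul_lt_one).mul_left
      (B * ((1 - Q.rho) * (Q.rho * ζ) ^ N)))
    have h1 : |∑' i, Q.statProb (i + N) *
        (Q.relValue (i + N, false) - Q.relValue (i + N, true))| ≤
        B * ((1 - Q.rho) * (Q.rho * ζ) ^ N) * (1 - Q.rho * ζ)⁻¹ := by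
      refine tsum_of_norm_bounded (f := fun i => Q.statProb (i + N) *
        (Q.relValue (i + N, false) - Q.relValue (i + N, true))) hgeo fun i => ?_
      refine (norm_statProb_mul_le hd (i + N)).trans (le_of_eq ?_)
      rw [statProb, mul_pow, mul_pow, pow_add, pow_add]
      ring
    have hX : 0 < ε * (1 - Q.eta ζ) * (1 - Q.rho * ζ) / (4 * u * (1 - Q.rho)) := by positivity
    have h2 : (Q.rho * ζ) ^ N ≤
        ε * (1 - Q.eta ζ) * (1 - Q.rho * ζ) / (4 * u * (1 - Q.rho)) := by
      rw [← Real.rpow_natCast]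
      refine (Real.logb_le_iff_le_rpow_of_base_lt_one hζ.rho_mul_pos hζ.rho_mul_lt_one hX).1 ?_
      refine (Int.le_ceil _).trans ?_
      -- This also covers a negative `k̃_ε`, where `N = 0` and the tail is the whole series.
      have h3 : Q.ktilde ζ u ε ≤ (N : ℤ) := by omega
      exact_mod_cast h3
    refine h1.trans ?_
    calc B * ((1 - Q.rho) * (Q.rho * ζ) ^ N) * (1 - Q.rho * ζ)⁻¹
        ≤ B * ((1 - Q.rho) * (ε * (1 - Q.eta ζ) * (1 - Q.rho * ζ) / (4 * u * (1 - Q.rho)))) *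
          (1 - Q.rho * ζ)⁻¹ := by gcongr
      _ = ε / 2 := by rw [hB]; field_simp; norm_num
  have hhead : |∑ i ∈ Finset.range N, Q.statProb i *
        (Q.relValue (i, false) - Q.relValue (i, true)) -
      Q.approxSavedCost ζ u Q.relValue ε| ≤ ε / 2 := by
    rw [approxSavedCost, ← hN, ← Finset.sum_sub_distrib]
    refine (Finset.abs_sum_le_sum_abs _ _).trans ?_
    have h1 : ∀ i ∈ Finset.range N, |Q.statProb i *
          (Q.relValue (i, false) - Q.relValue (i, true)) -
        (1 - Q.rho) * Q.rho ^ i * (Q.relValue (i, false) -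
          Q.Htilde ζ u Q.relValue (ε / 2) (Q.ktilde ζ u ε).toNat i)| ≤
        Q.statProb i * (ε / 2) := by
      intro i hi
      -- A nonempty range forces `k̃_ε ≥ 0`, so `toNat` loses nothing here.
      have hi' : i ≤ (Q.ktilde ζ u ε).toNat := by
        have := Finset.mem_range.1 hi
        omega
      have e : Q.statProb i * (Q.relValue (i, false) - Q.relValue (i, true)) -
          (1 - Q.rho) * Q.rho ^ i * (Q.relValue (i, false) -
            Q.Htilde ζ u Q.relValue (ε / 2) (Q.ktilde ζ u ε).toNat i) =
          Q.statProb i * (Q.Htilde ζ u Q.relValue (ε / 2) (Q.ktilde ζ u ε).toNat i -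
            Q.relValue (i, true)) := by
        rw [statProb]; ring
      rw [e, abs_mul, abs_of_nonneg (Q.statProb_nonneg i)]
      exact mul_le_mul_of_nonneg_left
        (abs_Htilde_sub_relValue_le hζ hu (half_pos hε) hi') (Q.statProb_nonneg i)
    refine (Finset.sum_le_sum h1).trans ?_
    rw [← Finset.sum_mul]
    have h2 := sum_le_hasSum (Finset.range N) (fun i _ => Q.statProb_nonneg i) Q.hasSum_statProb
    exact mul_le_of_le_one_left (half_pos hε).le h2
  rw [← hs.sum_add_tsum_nat_add N, add_sub_right_comm]
  refine (abs_add_le _ _).trans ?_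
  linarith

end Weighted

end

end QueueModel

theorem mainTheorem6 (Q : QueueModel) (ζ : ℝ) (hζ : Q.Admissible ζ) :
    ∃ H : QState → ℝ,
      Q.IsRelativeValue ζ Q.gmu H ∧
      (∀ (g' : ℝ) (H' : QState → ℝ), Q.IsRelativeValue ζ g' H' → g' = Q.gmu ∧ H' = H) ∧
      (∃ u : ℝ, Q.IsCostBound ζ u) ∧
      ∃ s : ℝ, Q.IsOptimalSavedCost Q.statLaw s ∧
        ∀ u : ℝ, Q.IsCostBound ζ u → ∀ ε : ℝ, 0 < ε →
          (∀ i : ℕ, (i : ℤ) ≤ Q.ktilde ζ u ε →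
            |Q.Htilde ζ u H (ε / 2) (Q.ktilde ζ u ε).toNat i - H (i, true)| ≤ ε / 2) ∧
          |s - Q.approxSavedCost ζ u H ε| ≤ ε :=
  ⟨Q.relValue, QueueModel.isRelativeValue_relValue hζ,
    fun _ _ h => QueueModel.IsRelativeValue.unique hζ h,
    QueueModel.exists_isCostBound hζ, _, QueueModel.isOptimalSavedCost_statLaw hζ,
    fun _ hu _ hε => ⟨fun _ hi => QueueModel.abs_Htilde_sub_relValue_le hζ hu (half_pos hε)
      (by omega), QueueModel.abs_tsum_sub_approxSavedCost_le hζ hu hε⟩⟩
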